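/- Fix a graded local order $>$ on the monomials of $\mathbb C[x_1,\dots,x_n]$, i.e. a total order compatible with multiplication such that $|\alpha|>|\beta|$ implies $x^\alpha<x^\beta$. The initial monomial of a nonzero polynomial is its largest monomial; its initial degree is the smallest total degree of its terms, and its initial form is the sum of its terms of that degree. The local Hilbert series at the origin of an ideal $I$ is $\sum_{m\ge 0}h(m)t^m$, where $h(m)$ is the number of monomials of degree $m$ that are not the initial monomial of an element of $I$. A point $z$ is a \emph{regular zero of breadth $\kappa$ and order $d$} of a square polynomial system $\mathcal G=(g_1,\dots,g_n)$, $g_i\in\mathbb C[x_1,\dots,x_n]$, if it is an isolated zero of $\mathcal G$, the Jacobian of $\mathcal G$ at $z$ has nullity $\kappa$, and the ideal generated by the polynomials $g_i(x+z)$ has local Hilbert series $(1+t+\dots+t^{d-1})^\kappa$ at the origin. A square polynomial system $\mathcal P=(p_1,\dots,p_n)$ with an isolated zero at the origin is \emph{$(\kappa,k,\ell)$-pre-inflatable} if its Jacobian at the origin has nullity $\kappa$ and kernel spanned by the standard basis vectors $e_1,\dots,e_\kappa$, every term of $p_1,\dots,p_\kappa$ involving at least one of $x_{\kappa+1},\dots,x_n$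 has degree greater than $k$, and every term of $p_{\kappa+1},\dots,p_n$ involving no variables other than $x_1,\dots,x_\kappa$ has degree greater than $\ell$. \textbf{Theorem.} Let $z^\ast\in\mathbb C^n$ be a regular zero of breadth $\kappa$ and order $d$ of a square polynomial system $\mathcal G$ in $n$ variables. Then there is a locally invertible transformation which takes $\mathcal G$ to a square polynomial system $\mathcal P=(p_1,\dots,p_n)$ and $z^\ast$ to the origin; that is, there are a polynomial map $T:\mathbb C^n\to\mathbb C^n$ with $T(0)=z^\ast$, which restricts to a homeomorphism from an open neighbourhood of $0$ onto an open set with analytic inverse, and a matrix $U\in\mathbb C[x_1,\dots,x_n]^{n\times n}$ whose values are invertible at all points near $0$, such that $\mathcal P=U\cdot(\mathcal G\circ T)$. Moreover, the origin is a regular zero of breadth $\kappa$ and order $d$ of $\mathcal P$, the system $\mathcal P$ is $(\kappa,d,d)$-pre-inflatable, and \begin{enumerate} \item the initial degree of $p_i$ is equal to $d$ for $1\le i\le\kappa$; \item the initial forms of $p_1,\dots,p_\kappa$ have no common zero on the unit sphere in $x_1,\dots,x_\kappa$, i.e. at no point $x\in\mathbb C^n$ with $x_{\kappa+1}=\dots=x_n=0$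 and $\sum_j|x_j|^2=1$, and these initial forms are a regular sequence in $\mathbb C[x_1,\dots,x_n]$; \item the initial form of $p_i$ is $x_i$ for $\kappa+1\le i\le n$. \end{enumerate} -/

import Mathlib

noncomputable section

namespace Inflation

open MvPolynomial Topology Filter

/-- A square polynomial system: `n` polynomials in `n` complex variables. -/
abbrev SquareSystem (n : ℕ) : Type := Fin n → MvPolynomial (Fin n) ℂ

/-- A graded local order on the monomials in `n` variables (given by their exponent vectors):
a strict total order which is compatible with multiplication of monomials and in which a
monomial of larger total degree is smaller. -/
structure GradedLocalOrder (n : ℕ) where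
  lt : (Fin n →₀ ℕ) → (Fin n →₀ ℕ) → Prop
  isStrictTotalOrder : IsStrictTotalOrder (Fin n →₀ ℕ) lt
  add_right : ∀ α β γ : Fin n →₀ ℕ, lt α β → lt (α + γ) (β + γ)
  lt_of_degree : ∀ α β : Fin n →₀ ℕ, β.degree < α.degree → lt α β

/-- `α` is the exponent of the initial term of `f`: the largest monomial of `f`. -/
def IsInitialExponent {n : ℕ} (ord : GradedLocalOrder n) (f : MvPolynomial (Fin n) ℂ)
    (α : Fin n →₀ ℕ) : Prop :=
  α ∈ f.support ∧ ∀ β ∈ f.support, β ≠ α → ord.lt β α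

/-- `α` is the exponent of a standard monomial of the ideal `I`: it is not the initial
monomial of a polynomial in `I`. -/
def IsStandard {n : ℕ} (ord : GradedLocalOrder n) (I : Ideal (MvPolynomial (Fin n) ℂ))
    (α : Fin n →₀ ℕ) : Prop :=
  ¬ ∃ f ∈ I, IsInitialExponent ord f α

/-- The local Hilbert function of `I` at the origin: the number of standard monomials of total
degree `m` (there are only finitely many monomials of a given degree). -/
def hilbertFunction {n : ℕ} (ord : GradedLocalOrder n) (I : Ideal (MvPolynomial (Fin n) ℂ))
    (m : ℕ) : ℕ :=
  Set.ncard {α : Fin n →₀ ℕ | α.degree = m ∧ IsStandard ord I α}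

/-- The local Hilbert series of `I` at the origin. -/
def hilbertSeries {n : ℕ} (ord : GradedLocalOrder n) (I : Ideal (MvPolynomial (Fin n) ℂ)) :
    PowerSeries ℕ :=
  PowerSeries.mk (hilbertFunction ord I)

/-- The polynomial map `ℂⁿ → ℂⁿ` with the components `T`. -/
def polyMap {n : ℕ} (T : SquareSystem n) (x : Fin n → ℂ) : Fin n → ℂ :=
  fun i => eval x (T i)

/-- `P ∘ T`: substitution of the polynomial map `T` into the system `P`. -/
def comp {n : ℕ} (P T : SquareSystem n) : SquareSystem n :=
  fun i => bind₁ T (P i)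

/-- The system `x ↦ P (x + z)`, which moves the point `z` to the origin. -/
def translate {n : ℕ} (P : SquareSystem n) (z : Fin n → ℂ) : SquareSystem n :=
  comp P (fun i => X i + C (z i))

/-- The point `z` is an isolated zero of the system `P`. -/
def IsIsolatedZero {n : ℕ} (P : SquareSystem n) (z : Fin n → ℂ) : Prop :=
  polyMap P z = 0 ∧ ∀ᶠ x in 𝓝[≠] z, polyMap P x ≠ 0

/-- The Jacobian matrix of `P` at `z`. -/
def jacobian {n : ℕ} (P : SquareSystem n) (z : Fin n → ℂ) : Matrix (Fin n) (Fin n) ℂ :=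
  Matrix.of fun i j => eval z (pderiv j (P i))

/-- The kernel of the Jacobian of `P` at `z`. -/
def jacobianKer {n : ℕ} (P : SquareSystem n) (z : Fin n → ℂ) : Submodule ℂ (Fin n → ℂ) :=
  LinearMap.ker (jacobian P z).mulVecLin

/-- The breadth of `P` at `z`: the nullity of the Jacobian. -/
def breadth {n : ℕ} (P : SquareSystem n) (z : Fin n → ℂ) : ℕ :=
  Module.finrank ℂ (jacobianKer P z)

/-- `z` is a regular zero of breadth `κ` and order `d` of `P`: an isolated zero of breadth `κ`
at which the local Hilbert series is `(1 + t + ⋯ + t ^ (d - 1)) ^ κ`. -/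
def IsRegularZero {n : ℕ} (ord : GradedLocalOrder n) (P : SquareSystem n) (z : Fin n → ℂ)
    (κ d : ℕ) : Prop :=
  IsIsolatedZero P z ∧ breadth P z = κ ∧
    hilbertSeries ord (Ideal.span (Set.range (translate P z))) =
      (∑ j ∈ Finset.range d, (PowerSeries.X : PowerSeries ℕ) ^ j) ^ κ

/-- `P` is a `(κ, k, l)`-pre-inflatable system. The variables `x₁, …, x_κ` and the polynomials
`p₁, …, p_κ` are those with an index `i : Fin n` such that `i < κ`. -/
structure IsPreInflatable {n : ℕ} (P : SquareSystem n) (κ k l : ℕ) : Prop where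
  isolated : IsIsolatedZero P 0
  breadth_eq : breadth P 0 = κ
  ker_eq : jacobianKer P 0 =
    Submodule.span ℂ {v | ∃ i : Fin n, (i : ℕ) < κ ∧ v = Pi.single i 1}
  first : ∀ i : Fin n, (i : ℕ) < κ → ∀ α ∈ (P i).support,
    (∃ j : Fin n, κ ≤ (j : ℕ) ∧ α j ≠ 0) → k < α.degree
  last : ∀ i : Fin n, κ ≤ (i : ℕ) → ∀ α ∈ (P i).support,
    (∀ j : Fin n, κ ≤ (j : ℕ) → α j = 0) → l < α.degree

/-- The initial degree of `f`: the smallest total degree of a term of `f` (`⊤` for `f = 0`). -/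
def initialDegree {n : ℕ} (f : MvPolynomial (Fin n) ℂ) : ℕ∞ :=
  ⨅ α ∈ f.support, (α.degree : ℕ∞)

/-- The initial form of `f`: the sum of the terms of `f` of smallest total degree. -/
def initialForm {n : ℕ} (f : MvPolynomial (Fin n) ℂ) : MvPolynomial (Fin n) ℂ :=
  homogeneousComponent (initialDegree f).toNat f

/-- The polynomial map `T` is locally invertible at `a`: it restricts to a homeomorphism of an
open neighbourhood of `a` onto an open set, with an analytic inverse. -/
def IsLocallyInvertibleMapAt {n : ℕ} (T : SquareSystem n) (a : Fin n → ℂ) : Prop :=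
  ∃ e : OpenPartialHomeomorph (Fin n → ℂ) (Fin n → ℂ),
    a ∈ e.source ∧ Set.EqOn e (polyMap T) e.source ∧ AnalyticOnNhd ℂ e.symm e.target

/-- The polynomial matrix `U` is locally invertible at `a`: its values at all points near `a`
are invertible matrices. -/
def IsLocallyInvertibleMatrixAt {n : ℕ}
    (U : Matrix (Fin n) (Fin n) (MvPolynomial (Fin n) ℂ)) (a : Fin n → ℂ) : Prop :=
  ∀ᶠ x in 𝓝 a, IsUnit (U.map (eval x))

/-- `P` arises from `G` by a locally invertible transformation that moves the point `z` to the
origin: a locally invertible change of variables `T` with `T 0 = z`, followed by a locally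
invertible linear transformation of the equations, `P = U · (G ∘ T)`. -/
def IsLocallyInvertibleTransform {n : ℕ} (G : SquareSystem n) (z : Fin n → ℂ)
    (P : SquareSystem n) : Prop :=
  ∃ (T : SquareSystem n) (U : Matrix (Fin n) (Fin n) (MvPolynomial (Fin n) ℂ)),
    polyMap T 0 = z ∧ IsLocallyInvertibleMapAt T 0 ∧ IsLocallyInvertibleMatrixAt U 0 ∧
      P = U.mulVec (comp G T)

/-- The list of the initial forms of `p₁, …, p_κ`, in this order. -/
def initialForms {n : ℕ} (P : SquareSystem n) (κ : ℕ) : List (MvPolynomial (Fin n) ℂ) :=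
  ((List.finRange n).filter fun i : Fin n => (i : ℕ) < κ).map fun i => initialForm (P i)

end Inflation

end

/-!
The lengths of `ℂ[x] / (I + 𝔪 ^ k)`, where `𝔪` is the ideal of the origin, are the partial sums of
the local Hilbert function (`sum_hilbertFunction`), and they are unchanged by polynomial changes of
variables with invertible linear part and by polynomial matrices invertible at the origin
(`LocallyEquivalent.truncLength_eq`). Hence the Hilbert series is carried along by all the
transformations used, and it is available for whatever normal form has been reached.

*Normal form* (`exists_normalForm`). Linear algebra makes the linear part of `p_i` equal to `0` for
`i ≤ κ` and to `x_i` for `i > κ`. Substitutions `x_j ↦ x_j - ψ_j(x_1, …, x_κ)` with `j > κ` push the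
terms of `p_j` in the first `κ` variables alone beyond degree `d`, and subtracting multiples of
the `p_j` from the `p_i`, `i ≤ κ`, pushes the terms involving the last variables beyond degree `d`.

*Initial degrees* (`IsNormalForm.order_ge`). Modulo the system every polynomial is a combination of
monomials in the first `κ` variables. By the Hilbert series the length of the truncation at `𝔪 ^ d`
is the number of all such monomials of degree less than `d`, so they are independent and
`p_1, …, p_κ` have no terms of degree less than `d`.

*No common zero* (`IsNormalForm.exists_eval_ne_zero`). Suppose that the forms of degree `d` of
`p_1, …, p_κ` vanish at a point `a ≠ 0` of the space of the first `κ` coordinates. A linear change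
of variables puts `a` on the axis of a variable `x_{i₀}`. Then each equation has order at least `d`
for the weight `(1, …, 1, d, …, d)`, and also order at least `d + 1` for the weight which is `1` at
`i₀`, `2` at the other variables among the first `κ`, and `d + 1` elsewhere. So a monomial in an
element of the `s`-th power of the ideal has weights at least `d * s` and `(d + 1) * s`, and the
remaining monomials are independent modulo this power. Up to terms of lower order in `s` their
number exceeds `d ^ κ * s ^ n / n!` by a positive multiple of `s ^ n` (`exists_card_lt`). On the
other hand the length of the quotient by the `s`-th power is at most the length `d ^ κ` of the
quotient by the ideal times the number of monomials of degree less than `s`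
(`finrank_powIdeal_le`), a contradiction. This replaces multiplicity theory.

*Regular sequence.* By the Nullstellensatz the ideal of the forms of degree `d` contains powers of
`x_1, …, x_κ`, hence a regular sequence of length `κ`. Exchange arguments and prime avoidance in a
vector space over an infinite field show that one can choose such a sequence among the linear
combinations of the `κ` forms (`DepthGE.exists_list`). It is linearly independent, so it consists of
the forms of degree `d` after a recombination of `p_1, …, p_κ` by an invertible constant matrix
(`IsNormalForm.exists_isRegular`). These forms are nonzero, so they are the initial forms.
-/

noncomputable section

namespace Inflation

open MvPolynomial Topology Filter

/-! ### The filtration by weighted order -/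

section Weight

variable {σ R : Type*} [CommRing R]

/-- The ideal of the polynomials whose monomials all have `w`-weight at least `c`. For `w = 1` it
is the `c`-th power of the ideal of the origin. -/
def weightIdeal (w : σ → ℕ) (c : ℕ) : Ideal (MvPolynomial σ R) where
  carrier := {f | ∀ α, coeff α f ≠ 0 → c ≤ Finsupp.weight w α}
  add_mem' {f g} hf hg α h := by
    by_cases h1 : coeff α f = 0
    · exact hg α (by simpa [h1] using h)
    · exact hf α h1
  zero_mem' α h := by simp at h
  smul_mem' f g hg α h := by
    classical
    rw [smul_eq_mul, coeff_mul] at h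
    obtain ⟨x, hx, hx0⟩ := Finset.exists_ne_zero_of_sum_ne_zero h
    rw [Finset.HasAntidiagonal.mem_antidiagonal] at hx
    have := hg x.2 (right_ne_zero_of_mul hx0)
    rw [← hx, map_add]
    omega

lemma mem_weightIdeal {w : σ → ℕ} {c : ℕ} {f : MvPolynomial σ R} :
    f ∈ weightIdeal w c ↔ ∀ α, coeff α f ≠ 0 → c ≤ Finsupp.weight w α := Iff.rfl

lemma mul_mem_weightIdeal {w : σ → ℕ} {a b : ℕ} {f g : MvPolynomial σ R}
    (hf : f ∈ weightIdeal w a) (hg : g ∈ weightIdeal w b) : f * g ∈ weightIdeal w (a + b) := by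
  classical
  intro α h
  rw [coeff_mul] at h
  obtain ⟨x, hx, hx0⟩ := Finset.exists_ne_zero_of_sum_ne_zero h
  rw [Finset.HasAntidiagonal.mem_antidiagonal] at hx
  rw [← hx, map_add]
  exact add_le_add (hf _ (left_ne_zero_of_mul hx0)) (hg _ (right_ne_zero_of_mul hx0))

lemma weightIdeal_anti (w : σ → ℕ) {a b : ℕ} (h : a ≤ b) :
    (weightIdeal w b : Ideal (MvPolynomial σ R)) ≤ weightIdeal w a :=
  fun _ hf α hα => h.trans (hf α hα)

@[simp] lemma weightIdeal_zero (w : σ → ℕ) :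
    (weightIdeal w 0 : Ideal (MvPolynomial σ R)) = ⊤ :=
  eq_top_iff.2 fun _ _ _ _ => Nat.zero_le _

lemma mem_weightIdeal_zero (w : σ → ℕ) (f : MvPolynomial σ R) : f ∈ weightIdeal w 0 := by simp

lemma monomial_mem_weightIdeal {w : σ → ℕ} {c : ℕ} {α : σ →₀ ℕ} (a : R)
    (h : c ≤ Finsupp.weight w α) : monomial α a ∈ weightIdeal w c := by
  classical
  intro β hβ
  rw [coeff_monomial] at hβ
  split_ifs at hβ with h1
  · rwa [← h1]
  · exact absurd rfl hβ

lemma X_mem_weightIdeal {w : σ → ℕ} {c : ℕ} {i : σ} (h : c ≤ w i) :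
    (X i : MvPolynomial σ R) ∈ weightIdeal w c :=
  monomial_mem_weightIdeal 1 (by simpa [Finsupp.weight_single] using h)

lemma weightIdeal_mono {w w' : σ → ℕ} (h : ∀ i, w i ≤ w' i) (c : ℕ) :
    (weightIdeal w c : Ideal (MvPolynomial σ R)) ≤ weightIdeal w' c := by
  intro f hf α hα
  refine (hf α hα).trans ?_
  rw [Finsupp.weight_apply, Finsupp.weight_apply]
  exact Finset.sum_le_sum fun i _ => Nat.mul_le_mul_left _ (h i)

lemma pow_mem_weightIdeal {w : σ → ℕ} {a : ℕ} {f : MvPolynomial σ R}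
    (hf : f ∈ weightIdeal w a) (k : ℕ) : f ^ k ∈ weightIdeal w (k * a) := by
  induction k with
  | zero => simp
  | succ k ih => rw [pow_succ, Nat.succ_mul]; exact mul_mem_weightIdeal ih hf

lemma C_mul_mem_weightIdeal {w : σ → ℕ} {c : ℕ} {f : MvPolynomial σ R} (a : R)
    (hf : f ∈ weightIdeal w c) : C a * f ∈ weightIdeal w c :=
  Ideal.mul_mem_left _ _ hf

lemma mem_weightIdeal_of_coeff_sub {w : σ → ℕ} {c : ℕ} {f g : MvPolynomial σ R}
    (h : ∀ α, Finsupp.weight w α < c → coeff α f = coeff α g) : f - g ∈ weightIdeal w c := by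
  intro α hα
  by_contra hlt
  exact hα (by rw [coeff_sub, h α (not_le.1 hlt), sub_self])

lemma bind₁_monomial_mem {τ : Type*} {w : σ → ℕ} {w' : τ → ℕ} {T : τ → MvPolynomial σ R}
    (hT : ∀ i, T i ∈ weightIdeal w (w' i)) (α : τ →₀ ℕ) (a : R) :
    bind₁ T (monomial α a) ∈ weightIdeal w (Finsupp.weight w' α) := by
  rw [bind₁_monomial]
  refine C_mul_mem_weightIdeal _ ?_
  induction α using Finsupp.induction_linear with
  | zero => simp
  | add α β hα hβ =>
    classical
    have : (Finsupp.prod (α + β) fun i k => T i ^ k) =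
        (α.prod fun i k => T i ^ k) * (β.prod fun i k => T i ^ k) :=
      Finsupp.prod_add_index' (by simp) (by intros; rw [pow_add])
    change (Finsupp.prod (α + β) fun i k => T i ^ k) ∈ _
    rw [this, map_add]
    exact mul_mem_weightIdeal hα hβ
  | single i k =>
    change (Finsupp.prod (Finsupp.single i k) fun i k => T i ^ k) ∈ _
    rw [Finsupp.prod_single_index (by simp), Finsupp.weight_single]
    exact pow_mem_weightIdeal (hT i) k

/-- A substitution which respects weights on the variables respects them on all polynomials. -/
lemma bind₁_mem_weightIdeal {τ : Type*} {w : σ → ℕ} {w' : τ → ℕ} {T : τ → MvPolynomial σ R}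
    (hT : ∀ i, T i ∈ weightIdeal w (w' i)) {c : ℕ} {f : MvPolynomial τ R}
    (hf : f ∈ weightIdeal w' c) : bind₁ T f ∈ weightIdeal w c := by
  rw [f.as_sum, map_sum]
  refine Ideal.sum_mem _ fun α hα => ?_
  exact weightIdeal_anti w (hf α (mem_support_iff.1 hα)) (bind₁_monomial_mem hT α _)

lemma bind₁_sub_bind₁_monomial_mem {τ : Type*} {w : σ → ℕ} {w' : τ → ℕ}
    {T T' : τ → MvPolynomial σ R} (hT : ∀ i, T i ∈ weightIdeal w (w' i))
    (hTT' : ∀ i, T i - T' i ∈ weightIdeal w (w' i + 1)) (α : τ →₀ ℕ) (a : R) :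
    bind₁ T (monomial α a) - bind₁ T' (monomial α a) ∈
      weightIdeal w (Finsupp.weight w' α + 1) := by
  have hT' : ∀ i, T' i ∈ weightIdeal w (w' i) := fun i => by
    have := sub_mem (hT i) (weightIdeal_anti w (Nat.le_succ _) (hTT' i))
    simpa using this
  have key : ∀ α : τ →₀ ℕ, bind₁ T (monomial α 1) - bind₁ T' (monomial α 1) ∈
      weightIdeal w (Finsupp.weight w' α + 1) := by
    intro α
    induction α using Finsupp.induction_linear with
    | zero => simp
    | add α β hα hβ =>
      have h1 : (monomial (α + β) (1 : R)) = monomial α 1 * monomial β 1 := by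
        rw [monomial_mul, one_mul]
      rw [h1, map_mul, map_mul, map_add]
      have h2 := mul_mem_weightIdeal hα (bind₁_monomial_mem hT β 1)
      have h3 := mul_mem_weightIdeal (bind₁_monomial_mem hT' α 1) hβ
      have h4 : Finsupp.weight w' α + Finsupp.weight w' β + 1 ≤
          Finsupp.weight w' α + 1 + Finsupp.weight w' β := by omega
      have h5 := add_mem (weightIdeal_anti w h4 h2) h3
      rwa [sub_mul, mul_sub, sub_add_sub_cancel] at h5
    | single i k =>
      have h1 : (monomial (Finsupp.single i k) (1 : R)) = X i ^ k := by
        rw [X_pow_eq_monomial]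
      rw [h1, map_pow, map_pow, bind₁_X_right, bind₁_X_right, Finsupp.weight_single]
      clear h1
      induction k with
      | zero => simp
      | succ k ih =>
        have h2 := mul_mem_weightIdeal ih (hT i)
        have h3 := mul_mem_weightIdeal (pow_mem_weightIdeal (hT' i) k) (hTT' i)
        have h4 : (k + 1) • w' i + 1 ≤ k • w' i + 1 + w' i := by rw [succ_nsmul]; omega
        have h5 : (k + 1) • w' i + 1 ≤ k • w' i + (w' i + 1) := by rw [succ_nsmul]; omega
        have h6 := add_mem (weightIdeal_anti w h4 h2) (weightIdeal_anti w h5 h3)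
        rwa [sub_mul, mul_sub, sub_add_sub_cancel, ← pow_succ, ← pow_succ] at h6
  have h1 : monomial α a = C a * monomial α 1 := by simp [C_mul_monomial]
  rw [h1, map_mul, map_mul, bind₁_C_right, bind₁_C_right, ← mul_sub]
  exact C_mul_mem_weightIdeal _ (key α)

/-- Two substitutions which agree to higher order on the variables agree to higher order on all
polynomials. -/
lemma bind₁_sub_bind₁_mem {τ : Type*} {w : σ → ℕ} {w' : τ → ℕ}
    {T T' : τ → MvPolynomial σ R} (hT : ∀ i, T i ∈ weightIdeal w (w' i))
    (hTT' : ∀ i, T i - T' i ∈ weightIdeal w (w' i + 1)) {c : ℕ} {f : MvPolynomial τ R}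
    (hf : f ∈ weightIdeal w' c) : bind₁ T f - bind₁ T' f ∈ weightIdeal w (c + 1) := by
  rw [f.as_sum, map_sum, map_sum, ← Finset.sum_sub_distrib]
  refine Ideal.sum_mem _ fun α hα => ?_
  exact weightIdeal_anti w (Nat.succ_le_succ (hf α (mem_support_iff.1 hα)))
    (bind₁_sub_bind₁_monomial_mem hT hTT' α _)

lemma weight_one_eq_degree (α : σ →₀ ℕ) : Finsupp.weight (1 : σ → ℕ) α = α.degree := by
  have := congrArg (fun f => f α) (Finsupp.degree_eq_weight_one (σ := σ) (R := ℕ))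
  exact this.symm

lemma mem_weightIdeal_one {c : ℕ} {f : MvPolynomial σ R} :
    f ∈ weightIdeal 1 c ↔ ∀ α, coeff α f ≠ 0 → c ≤ α.degree := by
  simp only [mem_weightIdeal, weight_one_eq_degree]

end Weight

/-! ### The local Hilbert function and the lengths of truncations -/

/-- The dimension of the polynomial ring modulo `I` and the `k`-th power of the ideal of the
origin. -/
def truncLength {n : ℕ} (I : Ideal (MvPolynomial (Fin n) ℂ)) (k : ℕ) : ℕ :=
  Module.finrank ℂ (MvPolynomial (Fin n) ℂ ⧸ (I ⊔ weightIdeal 1 k))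

lemma exists_lt_max {A : Type*} (lt : A → A → Prop) [IsStrictTotalOrder A lt] (s : Finset A)
    (hs : s.Nonempty) : ∃ a ∈ s, ∀ b ∈ s, b ≠ a → lt b a := by
  classical
  let _ := linearOrderOfSTO lt
  obtain ⟨a, ha, hmax⟩ := s.exists_max_image id hs
  exact ⟨a, ha, fun b hb hne => lt_of_le_of_ne (hmax b hb) hne⟩

lemma exists_lt_min {A : Type*} (lt : A → A → Prop) [IsStrictTotalOrder A lt] (s : Finset A)
    (hs : s.Nonempty) : ∃ a ∈ s, ∀ b ∈ s, b ≠ a → lt a b := by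
  classical
  let _ := linearOrderOfSTO lt
  obtain ⟨a, ha, hmin⟩ := s.exists_min_image id hs
  exact ⟨a, ha, fun b hb hne => lt_of_le_of_ne (hmin b hb) hne.symm⟩

variable {n : ℕ}

/-- The exponents of degree less than `k`. -/
def expLT (n k : ℕ) : Finset (Fin n →₀ ℕ) := (Finsupp.finite_of_degree_lt (σ := Fin n) k).toFinset

@[simp] lemma mem_expLT {k : ℕ} {α : Fin n →₀ ℕ} : α ∈ expLT n k ↔ α.degree < k := by
  simp [expLT]

lemma mk_monomial_eq_zero {I : Ideal (MvPolynomial (Fin n) ℂ)} {k : ℕ} {α : Fin n →₀ ℕ}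
    (h : k ≤ α.degree) (c : ℂ) :
    Ideal.Quotient.mk (I ⊔ weightIdeal 1 k) (monomial α c) = 0 :=
  Ideal.Quotient.eq_zero_iff_mem.2 (Ideal.mem_sup_right
    (monomial_mem_weightIdeal c (by rwa [weight_one_eq_degree])))

/-- The standard monomials of degree less than `k` span the truncation. -/
lemma monomial_mem_span_standard (ord : GradedLocalOrder n) (I : Ideal (MvPolynomial (Fin n) ℂ))
    (k : ℕ) (α : Fin n →₀ ℕ) :
    Ideal.Quotient.mkₐ ℂ (I ⊔ weightIdeal 1 k) (monomial α 1) ∈ Submodule.span ℂ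
      ((fun β => Ideal.Quotient.mkₐ ℂ (I ⊔ weightIdeal 1 k) (monomial β 1)) ''
        {β | β.degree < k ∧ IsStandard ord I β}) := by
  classical
  set V := Submodule.span ℂ
      ((fun β => Ideal.Quotient.mkₐ ℂ (I ⊔ weightIdeal 1 k) (monomial β 1)) ''
        {β | β.degree < k ∧ IsStandard ord I β}) with hV
  have := ord.isStrictTotalOrder
  by_contra hα
  set bad := (expLT n k).filter
    (fun β => Ideal.Quotient.mkₐ ℂ (I ⊔ weightIdeal 1 k) (monomial β 1) ∉ V) with hbad
  have hlow : ∀ β : Fin n →₀ ℕ, β ∉ bad →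
      Ideal.Quotient.mkₐ ℂ (I ⊔ weightIdeal 1 k) (monomial β 1) ∈ V := by
    intro β hβ
    by_cases hd : β.degree < k
    · by_contra h
      exact hβ (Finset.mem_filter.2 ⟨mem_expLT.2 hd, h⟩)
    · have := mk_monomial_eq_zero (I := I) (not_lt.1 hd) 1
      rw [Ideal.Quotient.mkₐ_eq_mk, this]
      exact V.zero_mem
  have hne : bad.Nonempty := ⟨α, by_contra fun h => hα (hlow α h)⟩
  obtain ⟨γ, hγ, hmin⟩ := exists_lt_min ord.lt bad hne
  obtain ⟨hγk, hγV⟩ := Finset.mem_filter.1 hγ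
  have hstd : ¬ IsStandard ord I γ := fun h =>
    hγV (Submodule.subset_span ⟨γ, ⟨mem_expLT.1 hγk, h⟩, rfl⟩)
  rw [IsStandard, not_not] at hstd
  obtain ⟨f, hfI, hγf, hinit⟩ := hstd
  have hf0 : Ideal.Quotient.mkₐ ℂ (I ⊔ weightIdeal 1 k) f = 0 :=
    Ideal.Quotient.eq_zero_iff_mem.2 (Ideal.mem_sup_left hfI)
  have hmon : ∀ β : Fin n →₀ ℕ, ∀ c : ℂ, monomial β c = c • monomial β 1 := by
    intro β c; simp [smul_monomial]
  have hsum : f = monomial γ (coeff γ f) + ∑ β ∈ f.support.erase γ, monomial β (coeff β f) := by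
    rw [Finset.add_sum_erase _ (fun β => monomial β (coeff β f)) hγf]
    exact f.as_sum
  have h1 : Ideal.Quotient.mkₐ ℂ (I ⊔ weightIdeal 1 k) (monomial γ (coeff γ f)) ∈ V := by
    rw [hsum, map_add] at hf0
    rw [eq_neg_of_add_eq_zero_left hf0, map_sum]
    refine V.neg_mem (V.sum_mem fun β hβ => ?_)
    rw [hmon, map_smul]
    refine V.smul_mem _ (hlow β fun hb => ?_)
    obtain ⟨hβγ, hβf⟩ := Finset.mem_erase.1 hβ
    exact asymm_of ord.lt (hmin β hb hβγ) (hinit β hβf hβγ)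
  rw [hmon, map_smul] at h1
  exact hγV ((V.smul_mem_iff (mem_support_iff.1 hγf)).1 h1)

lemma span_standard_eq_top (ord : GradedLocalOrder n) (I : Ideal (MvPolynomial (Fin n) ℂ))
    (k : ℕ) : Submodule.span ℂ
      ((fun β => Ideal.Quotient.mkₐ ℂ (I ⊔ weightIdeal 1 k) (monomial β 1)) ''
        {β | β.degree < k ∧ IsStandard ord I β}) = ⊤ := by
  refine eq_top_iff.2 fun x _ => ?_
  obtain ⟨f, rfl⟩ := Ideal.Quotient.mkₐ_surjective ℂ _ x
  rw [f.as_sum, map_sum]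
  refine Submodule.sum_mem _ fun β _ => ?_
  have : monomial β (coeff β f) = coeff β f • monomial β (1 : ℂ) := by simp [smul_monomial]
  rw [this, map_smul]
  exact Submodule.smul_mem _ _ (monomial_mem_span_standard ord I k β)

lemma finite_standard (ord : GradedLocalOrder n) (I : Ideal (MvPolynomial (Fin n) ℂ))
    (k : ℕ) : {β : Fin n →₀ ℕ | β.degree < k ∧ IsStandard ord I β}.Finite :=
  (Finsupp.finite_of_degree_lt k).subset fun _ h => h.1

/-- A relation between standard monomials modulo `I` and the `k`-th power would, up to terms of high
degree, be an element of `I`, with a standard initial monomial. -/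
lemma linearIndependent_standard (ord : GradedLocalOrder n)
    (I : Ideal (MvPolynomial (Fin n) ℂ)) (k : ℕ) :
    LinearIndependent ℂ (fun β : {β : Fin n →₀ ℕ | β.degree < k ∧ IsStandard ord I β} =>
      Ideal.Quotient.mkₐ ℂ (I ⊔ weightIdeal 1 k) (monomial (β : Fin n →₀ ℕ) 1)) := by
  classical
  have := ord.isStrictTotalOrder
  rw [linearIndependent_iff']
  intro s c hc β hβ
  by_contra hcβ
  set f : MvPolynomial (Fin n) ℂ := ∑ γ ∈ s, monomial (γ : Fin n →₀ ℕ) (c γ) with hf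
  have hcoeff : ∀ δ, coeff δ f ≠ 0 → δ.degree < k ∧ IsStandard ord I δ := by
    intro δ hδ
    rw [hf, coeff_sum] at hδ
    obtain ⟨γ, hγ, hne⟩ := Finset.exists_ne_zero_of_sum_ne_zero hδ
    rw [coeff_monomial] at hne
    split_ifs at hne with h
    · rw [← h]; exact γ.2
    · exact absurd rfl hne
  have hfβ : coeff (β : Fin n →₀ ℕ) f = c β := by
    rw [hf, coeff_sum, Finset.sum_eq_single β]
    · simp
    · intro γ _ hne
      rw [coeff_monomial, if_neg]
      exact fun h => hne (Subtype.ext h)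
    · exact fun h => absurd hβ h
  have hfmem : f ∈ I ⊔ weightIdeal 1 k := by
    rw [← Ideal.Quotient.eq_zero_iff_mem, ← Ideal.Quotient.mkₐ_eq_mk ℂ, hf, map_sum, ← hc]
    refine Finset.sum_congr rfl fun γ _ => ?_
    rw [← map_smul, smul_monomial, smul_eq_mul, mul_one]
  obtain ⟨g, hg, r, hr, hgr⟩ := Submodule.mem_sup.1 hfmem
  have hne : f.support.Nonempty := ⟨β, by rw [mem_support_iff, hfβ]; exact hcβ⟩
  obtain ⟨α, hα, hmax⟩ := exists_lt_max ord.lt f.support hne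
  obtain ⟨hαk, hαs⟩ := hcoeff α (mem_support_iff.1 hα)
  have hr' := mem_weightIdeal_one.1 hr
  have hg' : ∀ δ, coeff δ g = coeff δ f - coeff δ r := by
    intro δ; rw [← hgr, coeff_add]; ring
  have hrα : coeff α r = 0 := by
    by_contra h
    exact absurd (hr' α h) (not_le.2 hαk)
  refine hαs ⟨g, hg, ?_, fun δ hδ hδα => ?_⟩
  · rw [mem_support_iff, hg', hrα, sub_zero]
    exact mem_support_iff.1 hα
  · by_cases hδf : coeff δ f = 0
    · refine ord.lt_of_degree _ _ (lt_of_lt_of_le hαk (hr' δ fun h => ?_))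
      rw [mem_support_iff, hg', hδf, h, sub_zero] at hδ
      exact hδ rfl
    · exact hmax δ (mem_support_iff.2 hδf) hδα

lemma finite_quotient_trunc (I : Ideal (MvPolynomial (Fin n) ℂ)) (k : ℕ) :
    Module.Finite ℂ (MvPolynomial (Fin n) ℂ ⧸ (I ⊔ weightIdeal 1 k)) := by
  classical
  refine ⟨(expLT n k).image fun β =>
    Ideal.Quotient.mkₐ ℂ (I ⊔ weightIdeal 1 k) (monomial β 1), ?_⟩
  refine eq_top_iff.2 fun x _ => ?_
  obtain ⟨f, rfl⟩ := Ideal.Quotient.mkₐ_surjective ℂ _ x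
  rw [f.as_sum, map_sum]
  refine Submodule.sum_mem _ fun β _ => ?_
  by_cases h : β.degree < k
  · have : monomial β (coeff β f) = coeff β f • monomial β (1 : ℂ) := by simp [smul_monomial]
    rw [this, map_smul]
    exact Submodule.smul_mem _ _ (Submodule.subset_span
      (Finset.mem_coe.2 (Finset.mem_image_of_mem _ (mem_expLT.2 h))))
  · rw [Ideal.Quotient.mkₐ_eq_mk, mk_monomial_eq_zero (not_lt.1 h)]
    exact Submodule.zero_mem _

/-- The partial sums of the local Hilbert function are the lengths of the truncations; in
particular they do not depend on the order. -/
lemma sum_hilbertFunction (ord : GradedLocalOrder n) (I : Ideal (MvPolynomial (Fin n) ℂ))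
    (k : ℕ) : ∑ m ∈ Finset.range k, hilbertFunction ord I m = truncLength I k := by
  classical
  have hfin := finite_standard ord I k
  have := hfin.fintype
  have hspan := span_standard_eq_top ord I k
  have hb := Module.finrank_eq_card_basis
    (Module.Basis.mk (linearIndependent_standard ord I k) (by
      rw [← hspan, Set.image_eq_range]))
  rw [truncLength, hb, ← Set.toFinset_card]
  rw [Finset.card_eq_sum_card_fiberwise (f := Finsupp.degree) (t := Finset.range k)]
  · refine Finset.sum_congr rfl fun m hm => ?_
    rw [hilbertFunction, ← Set.ncard_coe_finset]
    congr 1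
    ext α
    simp only [Set.mem_ofPred_eq, Finset.coe_filter, Set.mem_toFinset]
    have := Finset.mem_range.1 hm
    constructor
    · rintro ⟨h1, h2⟩; exact ⟨⟨by omega, h2⟩, h1⟩
    · rintro ⟨⟨_, h2⟩, h1⟩; exact ⟨h1, h2⟩
  · intro α hα
    have : α.degree < k ∧ IsStandard ord I α := by simpa using hα
    simpa using this.1

lemma hilbertSeries_eq_of_truncLength_eq (ord : GradedLocalOrder n)
    {I J : Ideal (MvPolynomial (Fin n) ℂ)} (h : ∀ k, truncLength I k = truncLength J k) :
    hilbertSeries ord I = hilbertSeries ord J := by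
  ext m
  simp only [hilbertSeries, PowerSeries.coeff_mk]
  have h1 := sum_hilbertFunction ord I (m + 1)
  have h2 := sum_hilbertFunction ord J (m + 1)
  rw [Finset.sum_range_succ, sum_hilbertFunction] at h1 h2
  have := h m
  have := h (m + 1)
  omega

/-- The tuples with `κ` entries less than `d` and with sum less than `k`. -/
def boxLT (κ d k : ℕ) : Finset (Fin κ → ℕ) :=
  (Fintype.piFinset fun _ : Fin κ => Finset.range d).filter fun p => ∑ i, p i < k

lemma sum_coeff_geom_pow (κ d k : ℕ) :
    ∑ m ∈ Finset.range k,
      PowerSeries.coeff m ((∑ j ∈ Finset.range d, (PowerSeries.X : PowerSeries ℕ) ^ j) ^ κ) =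
    (boxLT κ d k).card := by
  classical
  have h1 : (∑ j ∈ Finset.range d, (PowerSeries.X : PowerSeries ℕ) ^ j) ^ κ =
      ∑ p ∈ Fintype.piFinset (fun _ : Fin κ => Finset.range d),
        (PowerSeries.X : PowerSeries ℕ) ^ (∑ i, p i) := by
    have := Finset.prod_univ_sum (fun _ : Fin κ => Finset.range d)
      (fun _ j => (PowerSeries.X : PowerSeries ℕ) ^ j)
    simpa [Finset.prod_pow_eq_pow_sum] using this
  rw [h1]
  simp_rw [map_sum, PowerSeries.coeff_X_pow]
  rw [Finset.sum_comm, boxLT, Finset.card_filter]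
  refine Finset.sum_congr rfl fun p _ => ?_
  rw [Finset.sum_ite_eq' (Finset.range k) (∑ i, p i) (fun _ => 1)]
  simp only [Finset.mem_range]

lemma truncLength_eq_card (ord : GradedLocalOrder n) {I : Ideal (MvPolynomial (Fin n) ℂ)}
    {κ d : ℕ} (h : hilbertSeries ord I =
      (∑ j ∈ Finset.range d, (PowerSeries.X : PowerSeries ℕ) ^ j) ^ κ) (k : ℕ) :
    truncLength I k = (boxLT κ d k).card := by
  rw [← sum_hilbertFunction ord, ← sum_coeff_geom_pow, ← h]
  simp [hilbertSeries]

lemma card_boxLT_le (κ d k : ℕ) : (boxLT κ d k).card ≤ d ^ κ := by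
  refine (Finset.card_filter_le _ _).trans ?_
  simp

/-! ### Locally invertible transformations fixing the origin -/

lemma polyMap_zero_eq_zero_iff {P : SquareSystem n} :
    polyMap P 0 = 0 ↔ ∀ i, coeff 0 (P i) = 0 := by
  simp [polyMap, funext_iff, eval_zero, constantCoeff_eq]

lemma jacobian_zero_apply (P : SquareSystem n) (i j : Fin n) :
    jacobian P 0 i j = coeff (Finsupp.single j 1) (P i) := by
  rw [jacobian, Matrix.of_apply, eval_zero, constantCoeff_eq, coeff_pderiv]
  simp

lemma pderiv_bind₁ (T : SquareSystem n) (f : MvPolynomial (Fin n) ℂ) (j : Fin n) :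
    pderiv j (bind₁ T f) = ∑ k, bind₁ T (pderiv k f) * pderiv j (T k) := by
  classical
  induction f using MvPolynomial.induction_on with
  | C a => simp
  | add p q hp hq => simp [hp, hq, add_mul, Finset.sum_add_distrib]
  | mul_X p i hp =>
    rw [map_mul, bind₁_X_right, Derivation.leibniz, hp]
    simp only [Derivation.leibniz, smul_eq_mul, map_add, map_mul, bind₁_X_right, pderiv_X,
      add_mul, Finset.sum_add_distrib]
    congr 1
    · rw [Finset.sum_eq_single i]
      · simp
      · intro b _ hb; simp [hb.symm]
      · simp
    · rw [Finset.mul_sum]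
      exact Finset.sum_congr rfl fun k _ => by ring

lemma eval_bind₁_eq (T : SquareSystem n) (f : MvPolynomial (Fin n) ℂ) (x : Fin n → ℂ) :
    eval x (bind₁ T f) = eval (polyMap T x) f := by
  induction f using MvPolynomial.induction_on with
  | C a => simp
  | add p q hp hq => simp [hp, hq]
  | mul_X p i hp => simp [hp, polyMap]

lemma polyMap_comp (P T : SquareSystem n) (x : Fin n → ℂ) :
    polyMap (comp P T) x = polyMap P (polyMap T x) := by
  funext i
  have h := eval_bind₁_eq T (P i) x
  simp only [polyMap, comp] at h ⊢
  exact h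

lemma jacobian_comp (P T : SquareSystem n) (x : Fin n → ℂ) :
    jacobian (comp P T) x = jacobian P (polyMap T x) * jacobian T x := by
  ext i j
  rw [Matrix.mul_apply]
  simp only [jacobian, Matrix.of_apply, comp, pderiv_bind₁, map_sum, map_mul]
  refine Finset.sum_congr rfl fun k _ => ?_
  congr 1
  exact congrFun (polyMap_comp (fun _ => pderiv k (P i)) T x) i

lemma comp_comp (P T T' : SquareSystem n) : comp (comp P T) T' = comp P (comp T T') := by
  funext i
  exact bind₁_bind₁ T T' (P i)

lemma comp_mulVec (U : Matrix (Fin n) (Fin n) (MvPolynomial (Fin n) ℂ)) (P T : SquareSystem n) :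
    comp (U.mulVec P) T = (U.map (bind₁ T)).mulVec (comp P T) := by
  funext i
  simp [comp, Matrix.mulVec, dotProduct, map_sum]

lemma polyMap_mulVec (U : Matrix (Fin n) (Fin n) (MvPolynomial (Fin n) ℂ)) (P : SquareSystem n)
    (x : Fin n → ℂ) : polyMap (U.mulVec P) x = (U.map (eval x)).mulVec (polyMap P x) := by
  funext i
  simp [polyMap, Matrix.mulVec, dotProduct, map_sum]

/-- `Q` arises from `P` by a change of variables fixing the origin, with invertible linear part,
followed by a linear transformation of the equations which is invertible at the origin. -/
def LocallyEquivalent (P Q : SquareSystem n) : Prop :=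
  ∃ (T : SquareSystem n) (U : Matrix (Fin n) (Fin n) (MvPolynomial (Fin n) ℂ)),
    polyMap T 0 = 0 ∧ IsUnit (jacobian T 0) ∧ IsUnit (U.map (eval 0)) ∧ Q = U.mulVec (comp P T)

lemma polyMap_X (x : Fin n → ℂ) : polyMap X x = x := by
  funext i; simp [polyMap]

lemma jacobian_X (x : Fin n → ℂ) : jacobian X x = 1 := by
  ext i j
  simp [jacobian, pderiv_X, Matrix.one_apply, Pi.single_apply, apply_ite]

lemma comp_X (P : SquareSystem n) : comp P X = P := by
  funext i; simp [comp]

lemma LocallyEquivalent.of_comp {P T : SquareSystem n} (h0 : polyMap T 0 = 0)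
    (hT : IsUnit (jacobian T 0)) : LocallyEquivalent P (comp P T) :=
  ⟨T, 1, h0, hT, by rw [Matrix.map_one _ (map_zero _) (map_one _)]; exact isUnit_one, by simp⟩

lemma LocallyEquivalent.of_mulVec {P : SquareSystem n}
    {U : Matrix (Fin n) (Fin n) (MvPolynomial (Fin n) ℂ)} (hU : IsUnit (U.map (eval 0))) :
    LocallyEquivalent P (U.mulVec P) :=
  ⟨X, U, polyMap_X 0, by rw [jacobian_X]; exact isUnit_one, hU, by rw [comp_X]⟩

lemma LocallyEquivalent.trans {P Q R : SquareSystem n} (h : LocallyEquivalent P Q)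
    (h' : LocallyEquivalent Q R) : LocallyEquivalent P R := by
  obtain ⟨T, U, hT0, hT, hU, rfl⟩ := h
  obtain ⟨T', U', hT0', hT', hU', rfl⟩ := h'
  refine ⟨comp T T', U' * U.map (bind₁ T'), ?_, ?_, ?_, ?_⟩
  · rw [polyMap_comp, hT0', hT0]
  · rw [jacobian_comp, hT0']; exact hT.mul hT'
  · rw [Matrix.map_mul, Matrix.map_map]
    refine hU'.mul ?_
    convert hU using 2
    funext f
    rw [Function.comp_apply, eval_bind₁_eq, hT0']
  · rw [comp_mulVec, comp_comp, Matrix.mulVec_mulVec]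

lemma LocallyEquivalent.polyMap_zero {P Q : SquareSystem n} (h : LocallyEquivalent P Q)
    (hP : polyMap P 0 = 0) : polyMap Q 0 = 0 := by
  obtain ⟨T, U, hT0, hT, hU, rfl⟩ := h
  rw [polyMap_mulVec, polyMap_comp, hT0, hP, Matrix.mulVec_zero]

/-! ### Invariance of the truncation lengths -/

lemma degree_lt_two {α : Fin n →₀ ℕ} (h : α.degree < 2) :
    α = 0 ∨ ∃ j, α = Finsupp.single j 1 := by
  rcases Nat.lt_or_ge α.degree 1 with h0 | h1
  · exact Or.inl ((Finsupp.degree_eq_zero_iff α).1 (by omega))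
  · have h2 : α ∈ {α : Fin n →₀ ℕ | α.degree = 1} := by
      change α.degree = 1
      omega
    rw [← Finsupp.range_single_one] at h2
    obtain ⟨j, hj⟩ := h2
    exact Or.inr ⟨j, hj.symm⟩

lemma mem_weightIdeal_one_one {f : MvPolynomial (Fin n) ℂ} :
    f ∈ weightIdeal 1 1 ↔ coeff 0 f = 0 := by
  rw [mem_weightIdeal_one]
  constructor
  · intro h
    by_contra h0
    simpa using h 0 h0
  · intro h α hα
    by_contra hlt
    have : α = 0 := (Finsupp.degree_eq_zero_iff α).1 (by omega)
    exact hα (this ▸ h)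

lemma mem_weightIdeal_one_two {f : MvPolynomial (Fin n) ℂ} (h0 : coeff 0 f = 0)
    (h1 : ∀ j, coeff (Finsupp.single j 1) f = 0) : f ∈ weightIdeal 1 2 := by
  rw [mem_weightIdeal_one]
  intro α hα
  by_contra hlt
  rcases degree_lt_two (not_le.1 hlt) with rfl | ⟨j, rfl⟩
  · exact hα h0
  · exact hα (h1 j)

lemma coeff_single_sum_C_mul_X (c : Fin n → ℂ) (j : Fin n) :
    coeff (Finsupp.single j 1) (∑ k, C (c k) * X k) = c j := by
  classical
  rw [coeff_sum, Finset.sum_eq_single j]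
  · simp
  · intro b _ hb
    rw [coeff_C_mul, coeff_X, if_neg, mul_zero]
    intro h
    exact hb (Finsupp.single_left_injective one_ne_zero h)
  · simp

lemma sub_linear_mem {f : MvPolynomial (Fin n) ℂ} (h0 : coeff 0 f = 0) :
    f - ∑ j, C (coeff (Finsupp.single j 1) f) * X j ∈ weightIdeal 1 2 := by
  refine mem_weightIdeal_one_two ?_ fun j => ?_
  · rw [coeff_sub, h0, coeff_sum]
    simp
  · rw [coeff_sub, coeff_single_sum_C_mul_X, sub_self]

/-- The linear change of variables with the matrix `B`. -/
def linearSystem (B : Matrix (Fin n) (Fin n) ℂ) : SquareSystem n :=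
  fun i => ∑ j, C (B i j) * X j

lemma linearSystem_mem (B : Matrix (Fin n) (Fin n) ℂ) (i : Fin n) :
    linearSystem B i ∈ weightIdeal 1 1 :=
  Ideal.sum_mem _ fun _ _ => C_mul_mem_weightIdeal _ (X_mem_weightIdeal le_rfl)

lemma polyMap_linearSystem_zero (B : Matrix (Fin n) (Fin n) ℂ) :
    polyMap (linearSystem B) 0 = 0 :=
  polyMap_zero_eq_zero_iff.2 fun i => mem_weightIdeal_one_one.1 (linearSystem_mem B i)

lemma jacobian_linearSystem_zero (B : Matrix (Fin n) (Fin n) ℂ) :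
    jacobian (linearSystem B) 0 = B := by
  ext i j
  rw [jacobian_zero_apply, linearSystem, coeff_single_sum_C_mul_X]

lemma bind₁_linear_sub_mem {T T' : SquareSystem n} (hT : polyMap T 0 = 0)
    (hT' : polyMap T' 0 = 0) (h : jacobian T' 0 * jacobian T 0 = 1) (i : Fin n) :
    bind₁ T (T' i) - X i ∈ weightIdeal 1 2 := by
  have h0 : polyMap (comp T' T) 0 = 0 := by rw [polyMap_comp, hT, hT']
  have h1 : jacobian (comp T' T) 0 = 1 := by rw [jacobian_comp, hT, h]
  have h2 := polyMap_zero_eq_zero_iff.1 h0 i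
  have h3 := sub_linear_mem h2
  simp_rw [← jacobian_zero_apply, h1] at h3
  simpa [Matrix.one_apply, comp] using h3

lemma bind₁_sub_self_mem {A : SquareSystem n} (hA : ∀ i, A i - X i ∈ weightIdeal 1 2) {k : ℕ}
    {f : MvPolynomial (Fin n) ℂ} (hf : f ∈ weightIdeal 1 k) :
    bind₁ A f - f ∈ weightIdeal 1 (k + 1) := by
  have hA1 : ∀ i, A i ∈ weightIdeal 1 ((1 : Fin n → ℕ) i) := fun i => by
    have := add_mem (weightIdeal_anti 1 one_le_two (hA i))
      (X_mem_weightIdeal (w := 1) (c := 1) (i := i) le_rfl)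
    simpa using this
  have := bind₁_sub_bind₁_mem (T' := X) hA1 hA hf
  simpa using this

section Invariance

variable {T : SquareSystem n}

lemma mem_weightIdeal_one_of_polyMap_zero (hT0 : polyMap T 0 = 0) (i : Fin n) :
    T i ∈ weightIdeal 1 ((1 : Fin n → ℕ) i) :=
  mem_weightIdeal_one_one.2 (polyMap_zero_eq_zero_iff.1 hT0 i)

/-- A change of variables with invertible linear part is onto modulo powers of the maximal
ideal. -/
lemma exists_sub_bind₁_mem (hT0 : polyMap T 0 = 0) (hT : IsUnit (jacobian T 0)) (k : ℕ)
    (f : MvPolynomial (Fin n) ℂ) : ∃ g, f - bind₁ T g ∈ weightIdeal 1 k := by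
  obtain ⟨B, hB⟩ := hT.exists_left_inv
  induction k with
  | zero => exact ⟨0, mem_weightIdeal_zero _ _⟩
  | succ k ih =>
    obtain ⟨g, hg⟩ := ih
    have h1 := bind₁_sub_self_mem (bind₁_linear_sub_mem hT0 (polyMap_linearSystem_zero B)
      (by rw [jacobian_linearSystem_zero, hB])) hg
    refine ⟨g + bind₁ (linearSystem B) (f - bind₁ T g), ?_⟩
    rw [← neg_mem_iff]
    convert h1 using 1
    rw [← bind₁_bind₁]
    simp only [map_add, map_sub]
    ring

/-- A change of variables with invertible linear part does not raise the order. -/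
lemma mem_of_bind₁_mem (hT0 : polyMap T 0 = 0) (hT : IsUnit (jacobian T 0)) {k : ℕ}
    {f : MvPolynomial (Fin n) ℂ} (hf : bind₁ T f ∈ weightIdeal 1 k) : f ∈ weightIdeal 1 k := by
  obtain ⟨B, hB⟩ := hT.exists_right_inv
  have key : ∀ e ≤ k, f ∈ weightIdeal 1 e := by
    intro e
    induction e with
    | zero => exact fun _ => mem_weightIdeal_zero _ _
    | succ e ih =>
      intro he
      have h1 := bind₁_sub_self_mem (bind₁_linear_sub_mem (polyMap_linearSystem_zero B) hT0
        (by rw [jacobian_linearSystem_zero, hB])) (ih (by omega))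
      have h2 : bind₁ (linearSystem B) (bind₁ T f) ∈ weightIdeal 1 (e + 1) :=
        weightIdeal_anti 1 he (bind₁_mem_weightIdeal (linearSystem_mem B) hf)
      rw [bind₁_bind₁] at h2
      have := sub_mem h2 h1
      simpa using this
  exact key k le_rfl

lemma span_range_comp (P T : SquareSystem n) :
    Ideal.span (Set.range (comp P T)) = (Ideal.span (Set.range P)).map (bind₁ T) := by
  rw [Ideal.map_span, ← Set.range_comp]
  rfl

lemma comap_map_sup_weightIdeal (hT0 : polyMap T 0 = 0) (hT : IsUnit (jacobian T 0))
    (I : Ideal (MvPolynomial (Fin n) ℂ)) (k : ℕ) :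
    (I.map (bind₁ T) ⊔ weightIdeal 1 k).comap (bind₁ T) = I ⊔ weightIdeal 1 k := by
  apply le_antisymm
  · intro f hf
    rw [Ideal.mem_comap] at hf
    obtain ⟨g, hg, r, hr, hgr⟩ := Submodule.mem_sup.1 hf
    -- modulo order `k`, an element of the extended ideal is the image of an element of `I`
    have key : ∃ g' ∈ I, g - bind₁ T g' ∈ weightIdeal 1 k := by
      refine Submodule.span_induction ?_ ?_ ?_ ?_ hg
      · rintro _ ⟨a, ha, rfl⟩
        exact ⟨a, ha, by simp⟩
      · exact ⟨0, I.zero_mem, by simp⟩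
      · rintro x y - - ⟨a, ha, hax⟩ ⟨b, hb, hby⟩
        refine ⟨a + b, add_mem ha hb, ?_⟩
        rw [map_add, add_sub_add_comm]
        exact add_mem hax hby
      · rintro c x - ⟨a, ha, hax⟩
        obtain ⟨c', hc'⟩ := exists_sub_bind₁_mem hT0 hT k c
        refine ⟨c' * a, I.mul_mem_left _ ha, ?_⟩
        have h1 := add_mem (Ideal.mul_mem_left _ c hax)
          (Ideal.mul_mem_right (bind₁ T a) _ hc')
        rw [map_mul, smul_eq_mul]
        convert h1 using 1
        ring
    obtain ⟨g', hg', hgg'⟩ := key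
    have h1 : bind₁ T (f - g') ∈ weightIdeal 1 k := by
      rw [map_sub, ← hgr, add_sub_right_comm]
      exact add_mem hgg' hr
    exact Submodule.mem_sup.2 ⟨g', hg', f - g', mem_of_bind₁_mem hT0 hT h1, by ring⟩
  · rw [sup_le_iff]
    refine ⟨fun f hf => ?_, fun f hf => ?_⟩
    · exact Ideal.mem_comap.2 (Ideal.mem_sup_left (Ideal.mem_map_of_mem _ hf))
    · exact Ideal.mem_comap.2 (Ideal.mem_sup_right
        (bind₁_mem_weightIdeal (mem_weightIdeal_one_of_polyMap_zero hT0) hf))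

lemma truncLength_map (hT0 : polyMap T 0 = 0) (hT : IsUnit (jacobian T 0))
    (I : Ideal (MvPolynomial (Fin n) ℂ)) (k : ℕ) :
    truncLength (I.map (bind₁ T)) k = truncLength I k := by
  set ψ : MvPolynomial (Fin n) ℂ →ₐ[ℂ] _ :=
    (Ideal.Quotient.mkₐ ℂ (I.map (bind₁ T) ⊔ weightIdeal 1 k)).comp (bind₁ T) with hψ
  have hsurj : Function.Surjective ψ := by
    intro y
    obtain ⟨f, rfl⟩ := Ideal.Quotient.mkₐ_surjective ℂ _ y
    obtain ⟨g, hg⟩ := exists_sub_bind₁_mem hT0 hT k f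
    refine ⟨g, ?_⟩
    rw [hψ, AlgHom.comp_apply, Ideal.Quotient.mkₐ_eq_mk, eq_comm, Ideal.Quotient.eq]
    exact Ideal.mem_sup_right hg
  have hker : RingHom.ker ψ = I ⊔ weightIdeal 1 k := by
    rw [← comap_map_sup_weightIdeal hT0 hT I k]
    ext f
    rw [RingHom.mem_ker, hψ, AlgHom.comp_apply, Ideal.Quotient.mkₐ_eq_mk,
      Ideal.Quotient.eq_zero_iff_mem, Ideal.mem_comap]
  have e1 := (Ideal.quotientKerAlgEquivOfSurjective hsurj).toLinearEquiv.finrank_eq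
  have e2 := (Ideal.quotientEquivAlgOfEq ℂ hker).toLinearEquiv.finrank_eq
  rw [truncLength, truncLength, ← e1, e2]

/-- Polynomials with nonzero constant term are invertible modulo powers of the maximal ideal. -/
lemma exists_mul_sub_one_mem {u : MvPolynomial (Fin n) ℂ} (hu : coeff 0 u ≠ 0) (k : ℕ) :
    ∃ v, v * u - 1 ∈ weightIdeal 1 k := by
  set c := coeff 0 u with hc
  set r : MvPolynomial (Fin n) ℂ := 1 - C c⁻¹ * u with hr
  have hr1 : r ∈ weightIdeal 1 1 := by
    rw [mem_weightIdeal_one_one, hr, coeff_sub, coeff_C_mul, ← hc, inv_mul_cancel₀ hu]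
    simp
  refine ⟨(∑ i ∈ Finset.range k, r ^ i) * C c⁻¹, ?_⟩
  have h1 : (∑ i ∈ Finset.range k, r ^ i) * C c⁻¹ * u = 1 - r ^ k := by
    rw [← geom_sum_mul_neg, hr]
    ring
  rw [h1, ← neg_mem_iff]
  simpa using pow_mem_weightIdeal hr1 k

lemma span_mulVec_sup_weightIdeal (P : SquareSystem n)
    {U : Matrix (Fin n) (Fin n) (MvPolynomial (Fin n) ℂ)} (hU : IsUnit (U.map (eval 0))) (k : ℕ) :
    Ideal.span (Set.range (U.mulVec P)) ⊔ weightIdeal 1 k =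
      Ideal.span (Set.range P) ⊔ weightIdeal 1 k := by
  have hle : ∀ (V : Matrix (Fin n) (Fin n) (MvPolynomial (Fin n) ℂ)) (Q : SquareSystem n) i,
      V.mulVec Q i ∈ Ideal.span (Set.range Q) := by
    intro V Q i
    change ∑ j, V i j * Q j ∈ _
    exact Ideal.sum_mem _ fun j _ =>
      Ideal.mul_mem_left _ _ (Ideal.subset_span (Set.mem_range_self j))
  apply le_antisymm
  · refine sup_le_sup_right (Ideal.span_le.2 ?_) _
    rintro _ ⟨i, rfl⟩
    exact hle U P i
  · refine sup_le (Ideal.span_le.2 ?_) le_sup_right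
    rintro _ ⟨i, rfl⟩
    have hdet : coeff 0 U.det ≠ 0 := by
      have h1 := (Matrix.isUnit_iff_isUnit_det _).1 hU
      have h2 : (U.map (eval (0 : Fin n → ℂ))).det = eval 0 U.det :=
        (RingHom.map_det (eval (0 : Fin n → ℂ)) U).symm
      rw [h2, eval_zero, constantCoeff_eq] at h1
      exact h1.ne_zero
    obtain ⟨v, hv⟩ := exists_mul_sub_one_mem hdet k
    -- Cramer's rule, with the inverse of the determinant modulo order `k`
    have h1 : U.det * P i ∈ Ideal.span (Set.range (U.mulVec P)) := by
      have := hle U.adjugate (U.mulVec P) i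
      rwa [Matrix.mulVec_mulVec, Matrix.adjugate_mul, Matrix.smul_mulVec, Matrix.one_mulVec] at this
    have h2 := sub_mem (Ideal.mem_sup_left (T := weightIdeal 1 k) (Ideal.mul_mem_left _ v h1))
      (Ideal.mem_sup_right (Ideal.mul_mem_right (P i) _ hv))
    have h3 : v * (U.det * P i) - (v * U.det - 1) * P i = P i := by ring
    rwa [h3] at h2

end Invariance

lemma LocallyEquivalent.truncLength_eq {P Q : SquareSystem n} (h : LocallyEquivalent P Q)
    (k : ℕ) :
    truncLength (Ideal.span (Set.range Q)) k = truncLength (Ideal.span (Set.range P)) k := by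
  obtain ⟨T, U, hT0, hT, hU, rfl⟩ := h
  rw [← truncLength_map hT0 hT (Ideal.span (Set.range P)), ← span_range_comp, truncLength,
    truncLength, span_mulVec_sup_weightIdeal _ hU]

/-! ### Local invertibility of polynomial maps and isolated zeros -/

/-- The linear map of a square matrix, as a continuous linear map. -/
def matrixCLM (A : Matrix (Fin n) (Fin n) ℂ) : (Fin n → ℂ) →L[ℂ] (Fin n → ℂ) :=
  LinearMap.toContinuousLinearMap A.mulVecLin

@[simp] lemma matrixCLM_apply (A : Matrix (Fin n) (Fin n) ℂ) (v : Fin n → ℂ) :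
    matrixCLM A v = A.mulVec v := rfl

/-- The linear isomorphism of an invertible matrix. -/
def matrixCLE (A : Matrix (Fin n) (Fin n) ℂ) (hA : IsUnit A) :
    (Fin n → ℂ) ≃L[ℂ] (Fin n → ℂ) :=
  ContinuousLinearEquiv.equivOfInverse (matrixCLM A) (matrixCLM A⁻¹)
    (fun v => by
      simp [Matrix.nonsing_inv_mul A ((Matrix.isUnit_iff_isUnit_det A).1 hA)])
    (fun v => by
      simp [Matrix.mul_nonsing_inv A ((Matrix.isUnit_iff_isUnit_det A).1 hA)])

lemma exists_hasFDerivAt_eval (f : MvPolynomial (Fin n) ℂ) (x : Fin n → ℂ) :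
    ∃ f' : (Fin n → ℂ) →L[ℂ] ℂ, HasFDerivAt (fun y : Fin n → ℂ => eval y f) f' x ∧
      ∀ v, f' v = ∑ j, eval x (pderiv j f) * v j := by
  classical
  induction f using MvPolynomial.induction_on with
  | C a =>
    refine ⟨0, ?_, fun v => by simp⟩
    simp only [eval_C]
    exact hasFDerivAt_const a x
  | add p q hp hq =>
    obtain ⟨p', hp, hp'⟩ := hp
    obtain ⟨q', hq, hq'⟩ := hq
    refine ⟨p' + q', ?_, fun v => ?_⟩
    · simp only [map_add]
      exact hp.add hq
    · change p' v + q' v = _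
      rw [hp', hq', ← Finset.sum_add_distrib]
      exact Finset.sum_congr rfl fun j _ => by rw [map_add, map_add, add_mul]
  | mul_X p i hp =>
    obtain ⟨p', hp, hp'⟩ := hp
    have hi : HasFDerivAt (fun y : Fin n → ℂ => y i)
        (ContinuousLinearMap.proj i : (Fin n → ℂ) →L[ℂ] ℂ) x := hasFDerivAt_apply i x
    refine ⟨eval x p • (ContinuousLinearMap.proj i : (Fin n → ℂ) →L[ℂ] ℂ) + x i • p', ?_,
      fun v => ?_⟩
    · simp only [map_mul, eval_X]
      exact hp.mul hi
    · change eval x p * v i + x i * p' v = _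
      have h1 : ∀ j, eval x (pderiv j (p * X i)) * v j =
          (if j = i then eval x p * v i else 0) + x i * (eval x (pderiv j p) * v j) := by
        intro j
        rw [Derivation.leibniz, pderiv_X]
        by_cases h : j = i
        · subst h; simp; ring
        · simp [h]; ring
      rw [Finset.sum_congr rfl fun j _ => h1 j, Finset.sum_add_distrib, Finset.sum_ite_eq', hp',
        Finset.mul_sum]
      simp

lemma analyticAt_polyMap (T : SquareSystem n) (x : Fin n → ℂ) :
    AnalyticAt ℂ (polyMap T) x :=
  AnalyticAt.pi fun i => AnalyticOnNhd.eval_mvPolynomial (T i) x trivial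

lemma hasFDerivAt_polyMap (T : SquareSystem n) (x : Fin n → ℂ) :
    HasFDerivAt (polyMap T) (matrixCLM (jacobian T x)) x := by
  rw [hasFDerivAt_pi']
  intro i
  obtain ⟨f', hf, hf'⟩ := exists_hasFDerivAt_eval (T i) x
  refine hf.congr_fderiv (ContinuousLinearMap.ext fun v => ?_)
  rw [hf']
  rfl

lemma hasStrictFDerivAt_polyMap (T : SquareSystem n) (x : Fin n → ℂ) :
    HasStrictFDerivAt (polyMap T) (matrixCLM (jacobian T x)) x := by
  have := (analyticAt_polyMap T x).hasStrictFDerivAt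
  rwa [(hasFDerivAt_polyMap T x).fderiv] at this

lemma isOpen_isUnit_map_eval (U : Matrix (Fin n) (Fin n) (MvPolynomial (Fin n) ℂ)) :
    IsOpen {x : Fin n → ℂ | IsUnit (U.map (eval x))} := by
  have h : {x : Fin n → ℂ | IsUnit (U.map (eval x))} = {x | eval x U.det ≠ 0} := by
    ext x
    change IsUnit (U.map (eval x)) ↔ eval x U.det ≠ 0
    have h2 : (U.map (eval x)).det = eval x U.det := (RingHom.map_det (eval x) U).symm
    rw [Matrix.isUnit_iff_isUnit_det, h2, isUnit_iff_ne_zero]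
  rw [h]
  exact isOpen_ne.preimage (MvPolynomial.continuous_eval U.det)

lemma isLocallyInvertibleMatrixAt_of_isUnit
    {U : Matrix (Fin n) (Fin n) (MvPolynomial (Fin n) ℂ)} {a : Fin n → ℂ}
    (h : IsUnit (U.map (eval a))) : IsLocallyInvertibleMatrixAt U a :=
  (isOpen_isUnit_map_eval U).mem_nhds h

/-- The inverse function theorem for polynomial maps. -/
lemma isLocallyInvertibleMapAt_of_isUnit {T : SquareSystem n} {a : Fin n → ℂ}
    (h : IsUnit (jacobian T a)) : IsLocallyInvertibleMapAt T a := by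
  have hs : HasStrictFDerivAt (polyMap T)
      ((matrixCLE _ h : (Fin n → ℂ) ≃L[ℂ] (Fin n → ℂ)) : (Fin n → ℂ) →L[ℂ] (Fin n → ℂ)) a :=
    hasStrictFDerivAt_polyMap T a
  have hO : IsOpen {x : Fin n → ℂ | IsUnit (jacobian T x)} := isOpen_isUnit_map_eval _
  set e0 := hs.toOpenPartialHomeomorph (polyMap T) with he0
  have hcoe : (e0 : (Fin n → ℂ) → (Fin n → ℂ)) = polyMap T := rfl
  -- restricting to the points with invertible Jacobian makes the inverse analytic everywhere
  refine ⟨e0.restrOpen _ hO, ⟨hs.mem_toOpenPartialHomeomorph_source, h⟩, fun x _ => rfl, ?_⟩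
  intro y hy
  have hx := (e0.restrOpen _ hO).map_target hy
  refine OpenPartialHomeomorph.analyticAt_symm (i := matrixCLE _ hx.2) _ hy ?_ ?_
  · exact analyticAt_polyMap T _
  · exact (hasFDerivAt_polyMap T _).fderiv

lemma isIsolatedZero_mulVec_comp {P T : SquareSystem n}
    {U : Matrix (Fin n) (Fin n) (MvPolynomial (Fin n) ℂ)} {a : Fin n → ℂ}
    (hP : IsIsolatedZero P (polyMap T a)) (hT : IsUnit (jacobian T a))
    (hU : IsUnit (U.map (eval a))) : IsIsolatedZero (U.mulVec (comp P T)) a := by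
  refine ⟨by rw [polyMap_mulVec, polyMap_comp, hP.1, Matrix.mulVec_zero], ?_⟩
  have hs : HasStrictFDerivAt (polyMap T)
      ((matrixCLE _ hT : (Fin n → ℂ) ≃L[ℂ] (Fin n → ℂ)) : (Fin n → ℂ) →L[ℂ] (Fin n → ℂ)) a :=
    hasStrictFDerivAt_polyMap T a
  have h1 : Tendsto (polyMap T) (𝓝[≠] a) (𝓝[≠] (polyMap T a)) := by
    refine tendsto_nhdsWithin_of_tendsto_nhds_of_eventually_within _
      (hs.continuousAt.tendsto.mono_left nhdsWithin_le_nhds) ?_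
    exact hs.hasFDerivAt.eventually_ne ⟨_, (matrixCLE _ hT).antilipschitz⟩
  have h2 : ∀ᶠ x in 𝓝[≠] a, IsUnit (U.map (eval x)) :=
    nhdsWithin_le_nhds (isLocallyInvertibleMatrixAt_of_isUnit hU)
  filter_upwards [h1.eventually hP.2, h2] with x hx hUx h0
  rw [polyMap_mulVec, polyMap_comp] at h0
  obtain ⟨V, hV⟩ := hUx.exists_left_inv
  apply hx
  rw [← Matrix.one_mulVec (polyMap P _), ← hV, ← Matrix.mulVec_mulVec, h0, Matrix.mulVec_zero]

lemma jacobian_X_add_C (z x : Fin n → ℂ) :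
    jacobian (fun i => X i + C (z i)) x = 1 := by
  rw [← jacobian_X x]
  ext i j
  simp [jacobian]

lemma polyMap_X_add_C (z x : Fin n → ℂ) :
    polyMap (fun i => X i + C (z i)) x = x + z := by
  funext i; simp [polyMap]

lemma jacobian_translate (G : SquareSystem n) (z : Fin n → ℂ) :
    jacobian (translate G z) 0 = jacobian G z := by
  rw [translate, jacobian_comp, jacobian_X_add_C, polyMap_X_add_C, zero_add, mul_one]

lemma translate_zero (P : SquareSystem n) : translate P 0 = P := by
  have : (fun i => X i + C ((0 : Fin n → ℂ) i) : SquareSystem n) = X := by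
    funext i; simp
  rw [translate, this, comp_X]

lemma isIsolatedZero_translate {G : SquareSystem n} {z : Fin n → ℂ} (h : IsIsolatedZero G z) :
    IsIsolatedZero (translate G z) 0 := by
  have := isIsolatedZero_mulVec_comp (P := G) (T := fun i => X i + C (z i)) (U := 1) (a := 0)
    (by rwa [polyMap_X_add_C, zero_add]) (by rw [jacobian_X_add_C]; exact isUnit_one)
    (by rw [Matrix.map_one _ (map_zero _) (map_one _)]; exact isUnit_one)
  rwa [Matrix.one_mulVec] at this

lemma LocallyEquivalent.isIsolatedZero {P Q : SquareSystem n} (h : LocallyEquivalent P Q)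
    (hP : IsIsolatedZero P 0) : IsIsolatedZero Q 0 := by
  obtain ⟨T, U, hT0, hT, hU, rfl⟩ := h
  exact isIsolatedZero_mulVec_comp (by rwa [hT0]) hT hU

lemma LocallyEquivalent.isLocallyInvertibleTransform {G P : SquareSystem n} {z : Fin n → ℂ}
    (h : LocallyEquivalent (translate G z) P) : IsLocallyInvertibleTransform G z P := by
  obtain ⟨T, U, hT0, hT, hU, rfl⟩ := h
  refine ⟨comp (fun i => X i + C (z i)) T, U, ?_, ?_, isLocallyInvertibleMatrixAt_of_isUnit hU, ?_⟩
  · rw [polyMap_comp, hT0, polyMap_X_add_C, zero_add]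
  · apply isLocallyInvertibleMapAt_of_isUnit
    rwa [jacobian_comp, jacobian_X_add_C, one_mul]
  · rw [translate, comp_comp]

/-! ### Reduction to normal form -/

/-- The exponent `α` involves only the first `κ` variables. -/
def IsPure (κ : ℕ) (α : Fin n →₀ ℕ) : Prop := ∀ j : Fin n, κ ≤ (j : ℕ) → α j = 0

/-- The weight which is `1` on the first `κ` variables and `c` on the others. -/
def blockWeight (κ c : ℕ) : Fin n → ℕ := fun i => if (i : ℕ) < κ then 1 else c

lemma IsPure.weight_eq {κ : ℕ} {α : Fin n →₀ ℕ} (h : IsPure κ α) (c : ℕ) :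
    Finsupp.weight (blockWeight κ c) α = α.degree := by
  rw [Finsupp.weight_eq_sum, Finsupp.degree_eq_sum]
  refine Finset.sum_congr rfl fun i _ => ?_
  by_cases hi : (i : ℕ) < κ
  · simp [blockWeight, hi]
  · simp [h i (not_lt.1 hi)]

lemma degree_add_le_weight {κ c : ℕ} (hc : 1 ≤ c) {α : Fin n →₀ ℕ} (h : ¬ IsPure κ α) :
    α.degree + c ≤ Finsupp.weight (blockWeight κ c) α + 1 := by
  classical
  rw [IsPure] at h
  push Not at h
  obtain ⟨j, hj, hj0⟩ := h
  rw [Finsupp.weight_eq_sum, Finsupp.degree_eq_sum, ← Finset.add_sum_erase _ _ (Finset.mem_univ j),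
    ← Finset.add_sum_erase (a := j) _ (fun i => α i • blockWeight κ c i) (Finset.mem_univ j)]
  have h1 : ∑ i ∈ Finset.univ.erase j, α i ≤
      ∑ i ∈ Finset.univ.erase j, α i • blockWeight κ c i := by
    refine Finset.sum_le_sum fun i _ => ?_
    rw [smul_eq_mul]
    refine Nat.le_mul_of_pos_right _ ?_
    rw [blockWeight]
    split_ifs <;> omega
  have h2 : α j + c ≤ α j * c + 1 := by
    obtain ⟨a, ha⟩ := Nat.exists_eq_succ_of_ne_zero hj0
    obtain ⟨b, rfl⟩ := Nat.exists_eq_add_of_le hc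
    rw [ha]
    nlinarith [Nat.zero_le (a * b)]
  have h3 : blockWeight κ c j = c := by simp [blockWeight, not_lt.2 hj]
  rw [smul_eq_mul, h3]
  omega

/-- A system in normal form up to degree `d`: the linear part of `p_i` is `0` for `i ≤ κ` and `x_i`
for `i > κ`, and the terms excluded by `(κ, d, d)`-pre-inflatability are absent. -/
structure IsNormalForm (P : SquareSystem n) (κ d : ℕ) : Prop where
  low : ∀ i : Fin n, (i : ℕ) < κ → P i ∈ weightIdeal 1 2
  lin : ∀ j : Fin n, κ ≤ (j : ℕ) → P j - X j ∈ weightIdeal 1 2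
  pure_high : ∀ j : Fin n, κ ≤ (j : ℕ) → ∀ α, coeff α (P j) ≠ 0 → IsPure κ α → d < α.degree
  mixed_high : ∀ i : Fin n, (i : ℕ) < κ → ∀ α, coeff α (P i) ≠ 0 → ¬ IsPure κ α → d < α.degree

/-- Every square matrix of nullity `κ` is equivalent to a diagonal idempotent. -/
lemma exists_mul_mul_eq_diagonal (M : Matrix (Fin n) (Fin n) ℂ) {κ : ℕ}
    (h : Module.finrank ℂ (LinearMap.ker M.mulVecLin) = κ) :
    ∃ A B : Matrix (Fin n) (Fin n) ℂ, IsUnit A ∧ IsUnit B ∧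
      A * M * B = Matrix.diagonal fun i : Fin n => if (i : ℕ) < κ then 0 else 1 := by
  classical
  obtain ⟨V, U, e, hV, hU, hVU⟩ := M.exists_rank_normal_form
  have hr : M.rank + κ = n := by
    have := M.mulVecLin.finrank_range_add_finrank_ker
    rw [h] at this
    simpa [Matrix.rank] using this
  have hcard : Fintype.card {i : Fin n // κ ≤ (i : ℕ)} = M.rank := by
    have h1 : Fintype.card {i : Fin n // ¬ κ ≤ (i : ℕ)} = κ := by
      rw [Fintype.card_subtype]
      simp only [not_le]
      rw [Fin.card_filter_val_lt]
      omega
    have h3 := Fintype.card_subtype_compl (fun i : Fin n => κ ≤ (i : ℕ))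
    have h4 := Fintype.card_subtype_le (fun i : Fin n => κ ≤ (i : ℕ))
    rw [h1, Fintype.card_fin] at h3
    rw [Fintype.card_fin] at h4
    omega
  let f : Fin n ≃ Fin M.rank ⊕ Fin (Fintype.card (Fin n) - M.rank) :=
    (Equiv.sumCompl (fun i : Fin n => κ ≤ (i : ℕ))).symm.trans <|
      (Fintype.equivFinOfCardEq hcard).sumCongr <| Fintype.equivFinOfCardEq <| by
        rw [Fintype.card_subtype_compl, hcard]
  let s : Fin n ≃ Fin n := f.trans e.symm
  refine ⟨V.submatrix s (Equiv.refl _), U.submatrix (Equiv.refl _) s, ?_, ?_, ?_⟩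
  · exact (Matrix.isUnit_submatrix_equiv s (Equiv.refl _)).2 hV
  · exact (Matrix.isUnit_submatrix_equiv (Equiv.refl _) s).2 hU
  · have h1 : V.submatrix s (Equiv.refl _) * M * U.submatrix (Equiv.refl _) s =
        (V * M * U).submatrix s s := by
      ext i j
      simp [Matrix.mul_apply]
    rw [h1, hVU, Matrix.submatrix_submatrix]
    have h2 : (e ∘ s : Fin n → _) = f := by
      funext i; simp [s]
    rw [h2, ← Matrix.diagonal_one, ← Matrix.diagonal_zero, Matrix.fromBlocks_diagonal,
      Matrix.submatrix_diagonal_equiv]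
    refine congrArg _ (funext fun i => ?_)
    by_cases hi : κ ≤ (i : ℕ)
    · simp [f, hi]
    · simp [f, hi, not_le.1 hi]

/-- The linear normal form. -/
lemma exists_linear_normalForm {P : SquareSystem n} (hP : polyMap P 0 = 0) {κ : ℕ}
    (hκ : breadth P 0 = κ) : ∃ Q, LocallyEquivalent P Q ∧
      (∀ i : Fin n, (i : ℕ) < κ → Q i ∈ weightIdeal 1 2) ∧
      (∀ j : Fin n, κ ≤ (j : ℕ) → Q j - X j ∈ weightIdeal 1 2) := by
  classical
  obtain ⟨A, B, hA, hB, hAB⟩ := exists_mul_mul_eq_diagonal (jacobian P 0) hκ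
  have e1 := LocallyEquivalent.of_comp (P := P) (polyMap_linearSystem_zero B)
    (by rwa [jacobian_linearSystem_zero])
  set Q₁ := comp P (linearSystem B) with hQ₁
  have hQ₁0 := e1.polyMap_zero hP
  have hJ₁ : jacobian Q₁ 0 = jacobian P 0 * B := by
    rw [hQ₁, jacobian_comp, jacobian_linearSystem_zero, polyMap_linearSystem_zero]
  have hCA : (A.map C).map (eval (0 : Fin n → ℂ)) = A := by
    ext i j; simp
  have e2 := LocallyEquivalent.of_mulVec (P := Q₁) (U := A.map C) (by rwa [hCA])
  set Q := (A.map C).mulVec Q₁ with hQ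
  have hQ0 := e2.polyMap_zero hQ₁0
  have hcoeff : ∀ i j, coeff (Finsupp.single j 1) (Q i) =
      if i = j then (if (i : ℕ) < κ then 0 else 1) else 0 := by
    intro i j
    have h1 : coeff (Finsupp.single j 1) (Q i) = (A * jacobian P 0 * B) i j := by
      rw [mul_assoc, ← hJ₁, Matrix.mul_apply]
      simp only [jacobian_zero_apply]
      rw [hQ, Matrix.mulVec, dotProduct, coeff_sum]
      simp [coeff_C_mul]
    rw [h1, hAB, Matrix.diagonal_apply]
  refine ⟨Q, e1.trans e2, fun i hi => ?_, fun j hj => ?_⟩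
  · refine mem_weightIdeal_one_two (polyMap_zero_eq_zero_iff.1 hQ0 i) fun j => ?_
    rw [hcoeff]
    simp [hi]
  · refine mem_weightIdeal_one_two ?_ fun l => ?_
    · rw [coeff_sub, polyMap_zero_eq_zero_iff.1 hQ0 j]
      simp
    · rw [coeff_sub, hcoeff, if_neg (not_lt.2 hj), coeff_X]
      by_cases h : j = l
      · simp [h]
      · rw [if_neg h, if_neg, sub_zero]
        exact fun h' => h (Finsupp.single_left_injective one_ne_zero h')

open Classical in
/-- The part of `f` with the exponents satisfying `p`. -/
def monomialPart (p : (Fin n →₀ ℕ) → Prop) (f : MvPolynomial (Fin n) ℂ) :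
    MvPolynomial (Fin n) ℂ :=
  ∑ α ∈ f.support.filter p, monomial α (coeff α f)

open Classical in
lemma coeff_monomialPart (p : (Fin n →₀ ℕ) → Prop) (f : MvPolynomial (Fin n) ℂ)
    (α : Fin n →₀ ℕ) : coeff α (monomialPart p f) = if p α then coeff α f else 0 := by
  rw [monomialPart, coeff_sum]
  simp only [coeff_monomial]
  rw [Finset.sum_ite_eq' (f.support.filter p) α (fun β => coeff β f)]
  simp only [Finset.mem_filter, mem_support_iff]
  by_cases h1 : p α <;> by_cases h2 : coeff α f = 0 <;> simp [h1, h2]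

lemma monomialPart_mem {p : (Fin n →₀ ℕ) → Prop} {f : MvPolynomial (Fin n) ℂ} {w : Fin n → ℕ}
    {c : ℕ} (h : ∀ α, coeff α f ≠ 0 → p α → c ≤ Finsupp.weight w α) :
    monomialPart p f ∈ weightIdeal w c := by
  intro α hα
  rw [coeff_monomialPart] at hα
  by_cases hp : p α
  · rw [if_pos hp] at hα
    exact h α hα hp
  · rw [if_neg hp] at hα
    exact absurd rfl hα

/-- A substitution which fixes the first `κ` variables fixes the polynomials in these. -/
lemma bind₁_eq_self_of_pure {T : SquareSystem n} {κ : ℕ}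
    (hT : ∀ i : Fin n, (i : ℕ) < κ → T i = X i) {f : MvPolynomial (Fin n) ℂ}
    (hf : ∀ α, coeff α f ≠ 0 → IsPure κ α) : bind₁ T f = f := by
  conv_rhs => rw [f.as_sum]
  conv_lhs => rw [f.as_sum]
  rw [map_sum]
  refine Finset.sum_congr rfl fun α hα => ?_
  rw [bind₁_monomial, monomial_eq]
  congr 1
  refine Finset.prod_congr rfl fun i hi => ?_
  rw [hT i]
  by_contra h
  exact (Finsupp.mem_support_iff.1 hi) (hf α (mem_support_iff.1 hα) i (not_lt.1 h))

/-- One step of the removal of the terms of `p_j`, `j > κ`, in the first `κ` variables: the terms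
of degree `k + 1` are absorbed into the coordinate `x_j`. -/
lemma exists_shift {P : SquareSystem n} {κ k : ℕ}
    (hlow : ∀ i : Fin n, (i : ℕ) < κ → P i ∈ weightIdeal 1 2)
    (hlin : ∀ j : Fin n, κ ≤ (j : ℕ) → P j - X j ∈ weightIdeal 1 2) (hk : 1 ≤ k)
    (hP : ∀ j : Fin n, κ ≤ (j : ℕ) → P j - X j ∈ weightIdeal (blockWeight κ k) (k + 1)) :
    ∃ Q, LocallyEquivalent P Q ∧
      (∀ i : Fin n, (i : ℕ) < κ → Q i ∈ weightIdeal 1 2) ∧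
      (∀ j : Fin n, κ ≤ (j : ℕ) → Q j - X j ∈ weightIdeal 1 2) ∧
      (∀ j : Fin n, κ ≤ (j : ℕ) →
        Q j - X j ∈ weightIdeal (blockWeight κ (k + 1)) (k + 1 + 1)) := by
  classical
  set ψ : SquareSystem n := fun j =>
    if (j : ℕ) < κ then 0 else monomialPart (fun α => IsPure κ α ∧ α.degree = k + 1) (P j - X j)
    with hψ
  have hψw : ∀ j, ψ j ∈ weightIdeal (blockWeight κ (k + 1)) (k + 1) := by
    intro j
    by_cases hj : (j : ℕ) < κ
    · simp [hψ, hj]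
    · simp only [hψ, if_neg hj]
      exact monomialPart_mem fun α _ h => by rw [h.1.weight_eq, h.2]
  have hψ1 : ∀ j, ψ j ∈ weightIdeal 1 2 := by
    intro j
    by_cases hj : (j : ℕ) < κ
    · simp [hψ, hj]
    · simp only [hψ, if_neg hj]
      exact monomialPart_mem fun α _ h => by rw [weight_one_eq_degree, h.2]; omega
  have hψpure : ∀ j α, coeff α (ψ j) ≠ 0 → IsPure κ α := by
    intro j α hα
    by_cases hj : (j : ℕ) < κ
    · simp [hψ, hj] at hα
    · simp only [hψ, if_neg hj, coeff_monomialPart] at hα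
      split_ifs at hα with h
      · exact h.1
      · exact absurd rfl hα
  set T : SquareSystem n := fun j => X j - ψ j with hT
  have hTfix : ∀ i : Fin n, (i : ℕ) < κ → T i = X i := by
    intro i hi
    simp [hT, hψ, hi]
  have hT1 : ∀ i, T i ∈ weightIdeal 1 ((1 : Fin n → ℕ) i) := fun i =>
    sub_mem (X_mem_weightIdeal le_rfl) (weightIdeal_anti 1 one_le_two (hψ1 i))
  have hTw : ∀ i, T i ∈ weightIdeal (blockWeight κ (k + 1)) (blockWeight κ (k + 1) i) := by
    intro i
    refine sub_mem (X_mem_weightIdeal le_rfl) ?_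
    refine weightIdeal_anti _ ?_ (hψw i)
    rw [blockWeight]
    split_ifs <;> omega
  have hT0 : polyMap T 0 = 0 :=
    polyMap_zero_eq_zero_iff.2 fun i => mem_weightIdeal_one_one.1 (hT1 i)
  have hJ : jacobian T 0 = 1 := by
    ext i j
    have h1 : coeff (Finsupp.single j 1) (ψ i) = 0 := by
      by_contra h
      have := mem_weightIdeal_one.1 (hψ1 i) _ h
      simp at this
    rw [jacobian_zero_apply, hT, coeff_sub, h1, sub_zero, coeff_X, Matrix.one_apply]
    by_cases h : i = j
    · simp [h]
    · rw [if_neg h, if_neg]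
      exact fun h' => h (Finsupp.single_left_injective one_ne_zero h')
  have hQ : ∀ j : Fin n, κ ≤ (j : ℕ) →
      comp P T j - X j = bind₁ T (P j - X j - ψ j) := by
    intro j hj
    rw [map_sub, map_sub, bind₁_X_right, bind₁_eq_self_of_pure hTfix (hψpure j)]
    simp only [comp, hT]
    ring
  refine ⟨comp P T, LocallyEquivalent.of_comp hT0 (by rw [hJ]; exact isUnit_one),
    fun i hi => bind₁_mem_weightIdeal hT1 (hlow i hi), fun j hj => ?_, fun j hj => ?_⟩
  · rw [hQ j hj]
    exact bind₁_mem_weightIdeal hT1 (sub_mem (hlin j hj) (hψ1 j))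
  · rw [hQ j hj]
    refine bind₁_mem_weightIdeal hTw fun α hα => ?_
    rw [coeff_sub] at hα
    simp only [hψ, if_neg (not_lt.2 hj), coeff_monomialPart] at hα
    by_cases hp : IsPure κ α
    · have h0 : coeff α (P j - X j) ≠ 0 := by
        intro h
        rw [h] at hα
        simp at hα
      have h1 := hP j hj α h0
      rw [hp.weight_eq] at h1 ⊢
      have h2 : α.degree ≠ k + 1 := by
        intro h
        simp [hp, h] at hα
      omega
    · rw [if_neg (fun h => hp h.1), sub_zero] at hα
      have h1 := mem_weightIdeal_one.1 (hlin j hj) α hα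
      have h2 := degree_add_le_weight (c := k + 1) (by omega) hp
      omega

lemma sub_single_add_single {α : Fin n →₀ ℕ} {l : Fin n} (hl : α l ≠ 0) :
    α - Finsupp.single l 1 + Finsupp.single l 1 = α := by
  ext m
  by_cases hm : m = l
  · subst hm; simp; omega
  · simp [Ne.symm hm]

/-- One step of the removal of the terms of `p_i`, `i ≤ κ`, which involve the last variables. -/
lemma exists_elimination {P : SquareSystem n} {κ k : ℕ}
    (hlin : ∀ j : Fin n, κ ≤ (j : ℕ) → P j - X j ∈ weightIdeal 1 2) {f : MvPolynomial (Fin n) ℂ}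
    (hf : ∀ α, coeff α f ≠ 0 → ¬ IsPure κ α → k < α.degree) :
    ∃ a : Fin n → MvPolynomial (Fin n) ℂ, (∀ l : Fin n, (l : ℕ) < κ → a l = 0) ∧
      (∀ l, a l ∈ weightIdeal 1 k) ∧
      ∀ α, coeff α (f - ∑ l, a l * P l) ≠ 0 → ¬ IsPure κ α → k + 1 < α.degree := by
  classical
  -- for a term which is not pure, `j α` singles out one of the last variables dividing it; a
  -- predicate serves for this because there is no default variable when `n = 0`
  have hex : ∀ α : Fin n →₀ ℕ, ∃ j : Fin n → Prop,
      (¬ IsPure κ α → ∃ l, j = (fun m => m = l) ∧ κ ≤ (l : ℕ) ∧ α l ≠ 0) := by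
    intro α
    by_cases h : IsPure κ α
    · exact ⟨fun _ => False, fun h' => absurd h h'⟩
    · have h' := h
      rw [IsPure] at h'
      push Not at h'
      obtain ⟨l, hl⟩ := h'
      exact ⟨fun m => m = l, fun _ => ⟨l, rfl, hl⟩⟩
  choose j hj using hex
  set bad := f.support.filter (fun α => ¬ IsPure κ α ∧ α.degree = k + 1) with hbad
  set a : Fin n → MvPolynomial (Fin n) ℂ := fun l =>
    ∑ α ∈ bad, if j α l then monomial (α - Finsupp.single l 1) (coeff α f) else 0 with ha
  have hdeg : ∀ α ∈ bad, ∀ l, α l ≠ 0 → (α - Finsupp.single l 1).degree = k := by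
    intro α hα l hl
    have h1 := (Finset.mem_filter.1 hα).2.2
    have h2 := congrArg Finsupp.degree (sub_single_add_single hl)
    rw [map_add, Finsupp.degree_single] at h2
    omega
  refine ⟨a, fun l hl => ?_, fun l => ?_, ?_⟩
  · refine Finset.sum_eq_zero fun α hα => ?_
    obtain ⟨m, hm, hm1, -⟩ := hj α (Finset.mem_filter.1 hα).2.1
    rw [if_neg]
    rw [hm]
    rintro rfl
    omega
  · refine Ideal.sum_mem _ fun α hα => ?_
    obtain ⟨m, hm, -, hm2⟩ := hj α (Finset.mem_filter.1 hα).2.1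
    split_ifs with h
    · rw [hm] at h
      have h : l = m := h
      subst h
      exact monomial_mem_weightIdeal _ (by rw [weight_one_eq_degree, hdeg α hα l hm2])
    · exact zero_mem _
  · have hsum : ∑ l, a l * P l - monomialPart (fun α => ¬ IsPure κ α ∧ α.degree = k + 1) f ∈
        weightIdeal 1 (k + 2) := by
      have h1 : ∑ l, a l * P l = ∑ α ∈ bad,
          ∑ l, (if j α l then monomial (α - Finsupp.single l 1) (coeff α f) else 0) * P l := by
        simp only [ha, Finset.sum_mul]
        exact Finset.sum_comm
      have h2 : monomialPart (fun α => ¬ IsPure κ α ∧ α.degree = k + 1) f =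
          ∑ α ∈ bad, monomial α (coeff α f) := by
        rw [monomialPart, hbad]
        congr
      rw [h1, h2, ← Finset.sum_sub_distrib]
      refine Ideal.sum_mem _ fun α hα => ?_
      obtain ⟨m, hm, hm1, hm2⟩ := hj α (Finset.mem_filter.1 hα).2.1
      rw [Finset.sum_eq_single m]
      · have h2 : (monomial α (coeff α f) : MvPolynomial (Fin n) ℂ) =
            monomial (α - Finsupp.single m 1) (coeff α f) * X m := by
          rw [X, monomial_mul, sub_single_add_single hm2, mul_one]
        rw [if_pos (by rw [hm]), h2, ← mul_sub]
        exact mul_mem_weightIdeal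
          (monomial_mem_weightIdeal _ (by rw [weight_one_eq_degree, hdeg α hα m hm2])) (hlin m hm1)
      · intro l _ hl
        rw [if_neg (by rw [hm]; exact hl), zero_mul]
      · simp
    intro α hα hp
    by_contra hlt
    have h0 : coeff α (∑ l, a l * P l) =
        coeff α (monomialPart (fun α => ¬ IsPure κ α ∧ α.degree = k + 1) f) := by
      by_contra h
      have := mem_weightIdeal_one.1 hsum α (by rw [coeff_sub]; exact sub_ne_zero.2 h)
      omega
    rw [coeff_sub, h0, coeff_monomialPart] at hα
    by_cases hd : α.degree = k + 1
    · simp [hp, hd] at hα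
    · rw [if_neg (fun h => hd h.2), sub_zero] at hα
      have := hf α hα hp
      omega

/-- Every system with a zero of breadth `κ` at the origin has a normal form. -/
lemma exists_normalForm {P : SquareSystem n} (hP : polyMap P 0 = 0) {κ : ℕ}
    (hκ : breadth P 0 = κ) (d : ℕ) : ∃ Q, LocallyEquivalent P Q ∧ IsNormalForm Q κ d := by
  classical
  have step1 : ∀ k : ℕ, ∃ Q, LocallyEquivalent P Q ∧
      (∀ i : Fin n, (i : ℕ) < κ → Q i ∈ weightIdeal 1 2) ∧
      (∀ j : Fin n, κ ≤ (j : ℕ) → Q j - X j ∈ weightIdeal 1 2) ∧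
      (∀ j : Fin n, κ ≤ (j : ℕ) →
        Q j - X j ∈ weightIdeal (blockWeight κ (k + 1)) (k + 1 + 1)) := by
    intro k
    induction k with
    | zero =>
      obtain ⟨Q, h1, h2, h3⟩ := exists_linear_normalForm hP hκ
      refine ⟨Q, h1, h2, h3, fun j hj => weightIdeal_mono (fun i => ?_) _ (h3 j hj)⟩
      simp [blockWeight]
    | succ k ih =>
      obtain ⟨Q, h1, h2, h3, h4⟩ := ih
      obtain ⟨Q', h1', h⟩ := exists_shift h2 h3 (by omega) h4
      exact ⟨Q', h1.trans h1', h⟩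
  have step2 : ∀ k : ℕ, ∃ Q, LocallyEquivalent P Q ∧
      (∀ i : Fin n, (i : ℕ) < κ → Q i ∈ weightIdeal 1 2) ∧
      (∀ j : Fin n, κ ≤ (j : ℕ) → Q j - X j ∈ weightIdeal 1 2) ∧
      (∀ j : Fin n, κ ≤ (j : ℕ) →
        Q j - X j ∈ weightIdeal (blockWeight κ (d + 1)) (d + 1 + 1)) ∧
      ∀ i : Fin n, (i : ℕ) < κ → ∀ α, coeff α (Q i) ≠ 0 → ¬ IsPure κ α → k + 1 < α.degree := by
    intro k
    induction k with
    | zero =>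
      obtain ⟨Q, h1, h2, h3, h4⟩ := step1 d
      exact ⟨Q, h1, h2, h3, h4, fun i hi α hα _ => mem_weightIdeal_one.1 (h2 i hi) α hα⟩
    | succ k ih =>
      obtain ⟨Q, h1, h2, h3, h4, h5⟩ := ih
      have hex : ∀ i : Fin n, ∃ a : Fin n → MvPolynomial (Fin n) ℂ,
          (∀ l, a l ∈ weightIdeal 1 (k + 1)) ∧ ((i : ℕ) < κ →
          ∀ α, coeff α (Q i - ∑ l, a l * Q l) ≠ 0 → ¬ IsPure κ α → k + 1 + 1 < α.degree) ∧
          (κ ≤ (i : ℕ) → a = 0) := by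
        intro i
        by_cases hi : (i : ℕ) < κ
        · obtain ⟨a, ha1, ha2, ha3⟩ := exists_elimination h3 (h5 i hi)
          exact ⟨a, ha2, fun _ => ha3, fun h => absurd hi (not_lt.2 h)⟩
        · exact ⟨0, fun l => zero_mem _, fun h => absurd h hi, fun _ => rfl⟩
      choose a ha1 ha2 ha3 using hex
      have hQ0 := h1.polyMap_zero hP
      have hQ1 : ∀ i, Q i ∈ weightIdeal 1 1 := fun i =>
        mem_weightIdeal_one_one.2 (polyMap_zero_eq_zero_iff.1 hQ0 i)
      have hU : ∀ i, ((1 : Matrix (Fin n) (Fin n) (MvPolynomial (Fin n) ℂ)) -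
          Matrix.of a).mulVec Q i = Q i - ∑ l, a i l * Q l := by
        intro i
        rw [Matrix.sub_mulVec, Matrix.one_mulVec]
        rfl
      have hlast : ∀ j : Fin n, κ ≤ (j : ℕ) → Q j - ∑ l, a j l * Q l = Q j := by
        intro j hj
        simp [ha3 j hj]
      have e2 := LocallyEquivalent.of_mulVec (P := Q) (U := 1 - Matrix.of a) (by
        have : ((1 : Matrix (Fin n) (Fin n) (MvPolynomial (Fin n) ℂ)) - Matrix.of a).map
            (eval (0 : Fin n → ℂ)) = 1 := by
          ext i l
          have h0 : coeff 0 (a i l) = 0 :=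
            mem_weightIdeal_one_one.1 (weightIdeal_anti 1 (by omega) (ha1 i l))
          have h0' : eval (0 : Fin n → ℂ) (a i l) = 0 := by
            rw [eval_zero, constantCoeff_eq, h0]
          rw [Matrix.map_apply, Matrix.sub_apply, Matrix.of_apply, map_sub, h0', sub_zero,
            Matrix.one_apply, Matrix.one_apply]
          split_ifs <;> simp
        rw [this]
        exact isUnit_one)
      refine ⟨_, h1.trans e2, fun i hi => ?_, fun j hj => ?_, fun j hj => ?_, fun i hi => ?_⟩
      · rw [hU]
        refine sub_mem (h2 i hi) (Ideal.sum_mem _ fun l _ => ?_)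
        exact mul_mem_weightIdeal (weightIdeal_anti 1 (by omega) (ha1 i l)) (hQ1 l)
      · rw [hU, hlast j hj]
        exact h3 j hj
      · rw [hU, hlast j hj]
        exact h4 j hj
      · rw [hU]
        exact ha2 i hi
  obtain ⟨Q, h1, h2, h3, h4, h5⟩ := step2 d
  refine ⟨Q, h1, h2, h3, fun j hj α hα hp => ?_, fun i hi α hα hp => ?_⟩
  · by_contra hlt
    have hX : coeff α (X j : MvPolynomial (Fin n) ℂ) = 0 := by
      rw [coeff_X, if_neg]
      rintro rfl
      have := hp j hj
      simp at this
    have := h4 j hj α (by rwa [coeff_sub, hX, sub_zero])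
    rw [hp.weight_eq] at this
    omega
  · have := h5 i hi α hα hp
    omega

/-! ### The initial degrees of the first equations -/

open Classical in
/-- The exponents of degree less than `k` in the first `κ` variables. -/
def pureLT (n κ k : ℕ) : Finset (Fin n →₀ ℕ) := (expLT n k).filter (IsPure κ)

lemma mem_pureLT {κ k : ℕ} {α : Fin n →₀ ℕ} :
    α ∈ pureLT n κ k ↔ α.degree < k ∧ IsPure κ α := by
  simp [pureLT]

lemma sum_castLE_le_degree {κ : ℕ} (h : κ ≤ n) (α : Fin n →₀ ℕ) :
    ∑ i : Fin κ, α (Fin.castLE h i) ≤ α.degree := by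
  classical
  rw [Finsupp.degree_eq_sum, ← Finset.sum_image (f := fun i => α i) (s := Finset.univ)
    (g := Fin.castLE h) (fun a _ b _ hab => Fin.castLE_injective h hab)]
  exact Finset.sum_le_sum_of_subset (Finset.subset_univ _)

lemma card_pureLT_le {κ : ℕ} (h : κ ≤ n) (d : ℕ) :
    (pureLT n κ d).card ≤ (boxLT κ d d).card := by
  classical
  refine Finset.card_le_card_of_injOn (fun α i => α (Fin.castLE h i)) ?_ ?_
  · intro α hα
    have hα' := mem_pureLT.1 (Finset.mem_coe.1 hα)
    have h1 : ∑ i : Fin κ, α (Fin.castLE h i) < d :=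
      lt_of_le_of_lt (sum_castLE_le_degree h α) hα'.1
    refine Finset.mem_coe.2 (Finset.mem_filter.2 ⟨Fintype.mem_piFinset.2 fun i => ?_, h1⟩)
    exact Finset.mem_range.2 (lt_of_le_of_lt
      (Finset.single_le_sum (f := fun i : Fin κ => α (Fin.castLE h i))
        (fun _ _ => Nat.zero_le _) (Finset.mem_univ i)) h1)
  · intro α hα β hβ hαβ
    have hα' := (mem_pureLT.1 (Finset.mem_coe.1 hα)).2
    have hβ' := (mem_pureLT.1 (Finset.mem_coe.1 hβ)).2
    ext j
    by_cases hj : (j : ℕ) < κ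
    · exact congrFun hαβ ⟨j, hj⟩
    · rw [hα' j (not_lt.1 hj), hβ' j (not_lt.1 hj)]

/-- Modulo the system, every polynomial is a combination of monomials in the first `κ` variables:
the equation `p_j` replaces `x_j` by terms of higher degree. -/
lemma mk_mem_span_pure {P : SquareSystem n} {κ k : ℕ}
    (hlin : ∀ j : Fin n, κ ≤ (j : ℕ) → P j - X j ∈ weightIdeal 1 2) (f : MvPolynomial (Fin n) ℂ) :
    Ideal.Quotient.mkₐ ℂ (Ideal.span (Set.range P) ⊔ weightIdeal 1 k) f ∈
      Submodule.span ℂ (Set.range fun α : pureLT n κ k =>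
        Ideal.Quotient.mkₐ ℂ (Ideal.span (Set.range P) ⊔ weightIdeal 1 k)
          (monomial (α : Fin n →₀ ℕ) 1)) := by
  set V := Submodule.span ℂ (Set.range fun α : pureLT n κ k =>
        Ideal.Quotient.mkₐ ℂ (Ideal.span (Set.range P) ⊔ weightIdeal 1 k)
          (monomial (α : Fin n →₀ ℕ) 1)) with hV
  set π := Ideal.Quotient.mkₐ ℂ (Ideal.span (Set.range P) ⊔ weightIdeal 1 k) with hπ
  have key : ∀ m : ℕ, ∀ f ∈ weightIdeal 1 (k - m), π f ∈ V := by
    intro m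
    induction m with
    | zero =>
      intro f hf
      have : π f = 0 := Ideal.Quotient.eq_zero_iff_mem.2 (Ideal.mem_sup_right hf)
      rw [this]
      exact V.zero_mem
    | succ m ih =>
      intro f hf
      rw [f.as_sum, map_sum]
      refine V.sum_mem fun α hα => ?_
      have h1 := mem_weightIdeal_one.1 hf α (mem_support_iff.1 hα)
      by_cases h2 : k - m ≤ α.degree
      · exact ih _ (monomial_mem_weightIdeal _ (by rwa [weight_one_eq_degree]))
      by_cases hp : IsPure κ α
      · have h3 : monomial α (coeff α f) = coeff α f • monomial α (1 : ℂ) := by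
          simp [smul_monomial]
        rw [h3, map_smul]
        exact V.smul_mem _ (Submodule.subset_span ⟨⟨α, mem_pureLT.2 ⟨by omega, hp⟩⟩, rfl⟩)
      · rw [IsPure] at hp
        push Not at hp
        obtain ⟨l, hl, hl0⟩ := hp
        have h4 := congrArg Finsupp.degree (sub_single_add_single hl0)
        rw [map_add, Finsupp.degree_single] at h4
        have h5 : monomial α (coeff α f) =
            monomial (α - Finsupp.single l 1) (coeff α f) * P l -
              monomial (α - Finsupp.single l 1) (coeff α f) * (P l - X l) := by
          rw [← mul_sub, sub_sub_cancel, X, monomial_mul, sub_single_add_single hl0, mul_one]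
        have h6 : π (monomial (α - Finsupp.single l 1) (coeff α f) * P l) = 0 :=
          Ideal.Quotient.eq_zero_iff_mem.2 (Ideal.mem_sup_left
            (Ideal.mul_mem_left _ _ (Ideal.subset_span (Set.mem_range_self l))))
        rw [h5, map_sub, h6, zero_sub]
        refine V.neg_mem (ih _ (weightIdeal_anti 1 ?_ (mul_mem_weightIdeal
          (monomial_mem_weightIdeal (c := (α - Finsupp.single l 1).degree) _
            (by rw [weight_one_eq_degree])) (hlin l hl))))
        omega
  refine key k f ?_
  rw [Nat.sub_self]
  exact mem_weightIdeal_zero _ _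

/-- If the truncation of order `d` has the length of that of a complete intersection of `κ` forms of
degree `d`, then the first equations of a normal form have order at least `d`. -/
lemma IsNormalForm.order_ge {P : SquareSystem n} {κ d : ℕ} (hP : IsNormalForm P κ d)
    (hκ : κ ≤ n) (hlen : truncLength (Ideal.span (Set.range P)) d = (boxLT κ d d).card)
    (i : Fin n) (hi : (i : ℕ) < κ) : P i ∈ weightIdeal 1 d := by
  classical
  set π := Ideal.Quotient.mkₐ ℂ (Ideal.span (Set.range P) ⊔ weightIdeal 1 d) with hπ
  set v := fun α : pureLT n κ d => π (monomial (α : Fin n →₀ ℕ) 1) with hv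
  have hspan : ⊤ ≤ Submodule.span ℂ (Set.range v) := by
    intro x _
    obtain ⟨f, rfl⟩ := Ideal.Quotient.mkₐ_surjective ℂ _ x
    exact mk_mem_span_pure hP.lin f
  have hcard : Fintype.card (pureLT n κ d) = Module.finrank ℂ
      (MvPolynomial (Fin n) ℂ ⧸ (Ideal.span (Set.range P) ⊔ weightIdeal 1 d)) := by
    apply le_antisymm
    · have h1 := card_pureLT_le hκ d
      rw [← hlen] at h1
      rw [Fintype.card_coe]
      exact h1
    · have h1 := finrank_range_le_card (R := ℂ) v
      rw [Set.finrank, eq_top_iff.2 hspan, finrank_top] at h1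
      exact h1
  have hind : LinearIndependent ℂ v :=
    linearIndependent_of_top_le_span_of_card_eq_finrank hspan hcard
  have hzero : ∑ α : pureLT n κ d, coeff (α : Fin n →₀ ℕ) (P i) • v α = 0 := by
    have h1 : P i - ∑ α : pureLT n κ d, monomial (α : Fin n →₀ ℕ) (coeff (α : Fin n →₀ ℕ) (P i)) ∈
        weightIdeal 1 d := by
      refine mem_weightIdeal_of_coeff_sub fun β hβ => ?_
      rw [weight_one_eq_degree] at hβ
      rw [coeff_sum, Finset.sum_coe_sort (pureLT n κ d)
        (fun α => coeff β (monomial α (coeff α (P i))))]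
      simp only [coeff_monomial]
      rw [Finset.sum_ite_eq' (pureLT n κ d) β (fun α => coeff α (P i))]
      split_ifs with h
      · rfl
      · by_contra hne
        refine absurd (hP.mixed_high i hi β hne fun hp => h (mem_pureLT.2 ⟨hβ, hp⟩)) ?_
        omega
    have h2 : π (P i) = 0 := Ideal.Quotient.eq_zero_iff_mem.2
      (Ideal.mem_sup_left (Ideal.subset_span (Set.mem_range_self i)))
    have h3 : π (P i - ∑ α : pureLT n κ d,
        monomial (α : Fin n →₀ ℕ) (coeff (α : Fin n →₀ ℕ) (P i))) = 0 :=
      Ideal.Quotient.eq_zero_iff_mem.2 (Ideal.mem_sup_right h1)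
    rw [map_sub, h2, zero_sub, neg_eq_zero, map_sum] at h3
    rw [← h3]
    refine Finset.sum_congr rfl fun α _ => ?_
    rw [hv, ← map_smul, smul_monomial, smul_eq_mul, mul_one]
  have hcoeff := Fintype.linearIndependent_iff.1 hind _ hzero
  intro α hα
  rw [weight_one_eq_degree]
  by_contra hlt
  by_cases hp : IsPure κ α
  · exact hα (hcoeff ⟨α, mem_pureLT.2 ⟨not_le.1 hlt, hp⟩⟩)
  · have := hP.mixed_high i hi α hα hp
    omega

/-! ### Lengths of powers of an ideal -/

/-- The product of powers of the equations with the exponent `β`. -/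
def sysPow (q : SquareSystem n) (β : Fin n →₀ ℕ) : MvPolynomial (Fin n) ℂ :=
  bind₁ q (monomial β 1)

lemma sysPow_add (q : SquareSystem n) (β γ : Fin n →₀ ℕ) :
    sysPow q (β + γ) = sysPow q β * sysPow q γ := by
  rw [sysPow, sysPow, sysPow, ← map_mul, monomial_mul, mul_one]

lemma sysPow_single (q : SquareSystem n) (i : Fin n) : sysPow q (Finsupp.single i 1) = q i := by
  rw [sysPow]
  exact bind₁_X_right q i

/-- The `s`-th power of the ideal generated by the system, generated by the products of `s` of the
equations. -/
def powIdeal (q : SquareSystem n) (s : ℕ) : Ideal (MvPolynomial (Fin n) ℂ) :=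
  Ideal.span (sysPow q '' {β | β.degree = s})

lemma powIdeal_zero (q : SquareSystem n) : powIdeal q 0 = ⊤ := by
  rw [Ideal.eq_top_iff_one]
  exact Ideal.subset_span ⟨0, map_zero _, by simp [sysPow]⟩

lemma mul_sysPow_mem {q : SquareSystem n} {g : MvPolynomial (Fin n) ℂ}
    (hg : g ∈ Ideal.span (Set.range q)) (β : Fin n →₀ ℕ) :
    g * sysPow q β ∈ powIdeal q (β.degree + 1) := by
  refine Submodule.span_induction ?_ ?_ ?_ ?_ hg
  · rintro _ ⟨i, rfl⟩
    rw [← sysPow_single q i, ← sysPow_add]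
    refine Ideal.subset_span ⟨_, ?_, rfl⟩
    change Finsupp.degree _ = _
    rw [map_add, Finsupp.degree_single, add_comm]
  · rw [zero_mul]; exact zero_mem _
  · intro x y _ _ hx hy
    rw [add_mul]; exact add_mem hx hy
  · intro a x _ hx
    rw [smul_eq_mul, mul_assoc]; exact Ideal.mul_mem_left _ _ hx

lemma powIdeal_le_weightIdeal {q : SquareSystem n} {w : Fin n → ℕ} {c : ℕ}
    (hq : ∀ i, q i ∈ weightIdeal w c) (s : ℕ) : powIdeal q s ≤ weightIdeal w (c * s) := by
  refine Ideal.span_le.2 ?_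
  rintro _ ⟨β, hβ, rfl⟩
  have h1 := bind₁_monomial_mem (w' := fun _ => c) hq β 1
  have h2 : Finsupp.weight (fun _ : Fin n => c) β = c * s := by
    have hβ' : β.degree = s := hβ
    rw [Finsupp.weight_eq_sum, ← hβ', Finsupp.degree_eq_sum, Finset.mul_sum]
    exact Finset.sum_congr rfl fun i _ => by rw [smul_eq_mul, mul_comm]
  rwa [h2] at h1

/-- Representatives of a basis of the truncation, multiplied by the products of fewer than `s`
equations, span the truncation of the `s`-th power. -/
lemma exists_sub_mem_powIdeal (q : SquareSystem n) (k : ℕ) {D : ℕ}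
    (e : Fin D → MvPolynomial (Fin n) ℂ)
    (he : ∀ f, ∃ c : Fin D → ℂ, f - ∑ l, c l • e l ∈ Ideal.span (Set.range q) ⊔ weightIdeal 1 k)
    (s : ℕ) (f : MvPolynomial (Fin n) ℂ) :
    ∃ v ∈ Submodule.span ℂ (Set.range fun p : Fin D × expLT n s => e p.1 * sysPow q p.2),
      f - v ∈ powIdeal q s ⊔ weightIdeal 1 k := by
  induction s generalizing f with
  | zero => exact ⟨0, zero_mem _, by rw [powIdeal_zero]; simp⟩
  | succ s ih =>
    set V := Submodule.span ℂ
      (Set.range fun p : Fin D × expLT n (s + 1) => e p.1 * sysPow q p.2) with hV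
    obtain ⟨v, hv, hfv⟩ := ih f
    have hvV : v ∈ V := by
      refine Submodule.span_mono ?_ hv
      rintro _ ⟨⟨l, β⟩, rfl⟩
      exact ⟨⟨l, ⟨β, mem_expLT.2 (Nat.lt_succ_of_lt (mem_expLT.1 β.2))⟩⟩, rfl⟩
    obtain ⟨g, hg, r, hr, hgr⟩ := Submodule.mem_sup.1 hfv
    have key : ∀ g ∈ powIdeal q s, ∀ a, ∃ v' ∈ V,
        a * g - v' ∈ powIdeal q (s + 1) ⊔ weightIdeal 1 k := by
      intro g hg
      refine Submodule.span_induction ?_ ?_ ?_ ?_ hg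
      · rintro _ ⟨β, hβ, rfl⟩ a
        have hβ' : β.degree = s := hβ
        obtain ⟨c, hc⟩ := he a
        refine ⟨∑ l, c l • (e l * sysPow q β), V.sum_mem fun l _ => V.smul_mem _
          (Submodule.subset_span ⟨⟨l, ⟨β, mem_expLT.2 (by omega)⟩⟩, rfl⟩), ?_⟩
        have h1 : a * sysPow q β - ∑ l, c l • (e l * sysPow q β) =
            (a - ∑ l, c l • e l) * sysPow q β := by
          rw [sub_mul, Finset.sum_mul]
          simp only [smul_mul_assoc]
        obtain ⟨x, hx, y, hy, hxy⟩ := Submodule.mem_sup.1 hc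
        rw [h1, ← hxy, add_mul]
        have h2 := mul_sysPow_mem hx β
        rw [hβ'] at h2
        exact add_mem (Ideal.mem_sup_left h2)
          (Ideal.mem_sup_right (Ideal.mul_mem_right _ _ hy))
      · exact fun a => ⟨0, zero_mem _, by simp⟩
      · intro x y _ _ hx hy a
        obtain ⟨v1, h1, h1'⟩ := hx a
        obtain ⟨v2, h2, h2'⟩ := hy a
        refine ⟨v1 + v2, add_mem h1 h2, ?_⟩
        rw [mul_add, add_sub_add_comm]
        exact add_mem h1' h2'
      · intro b x _ hx a
        obtain ⟨v1, h1, h1'⟩ := hx (a * b)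
        exact ⟨v1, h1, by rwa [smul_eq_mul, ← mul_assoc]⟩
    obtain ⟨v', hv', hgv'⟩ := key g hg 1
    refine ⟨v + v', add_mem hvV hv', ?_⟩
    have h1 : f - (v + v') = (1 * g - v') + r := by
      rw [← sub_sub, ← hgr]; ring
    rw [h1]
    exact add_mem hgv' (Ideal.mem_sup_right hr)

lemma finrank_powIdeal_le (q : SquareSystem n) (k s : ℕ) :
    Module.finrank ℂ (MvPolynomial (Fin n) ℂ ⧸ (powIdeal q s ⊔ weightIdeal 1 k)) ≤
      truncLength (Ideal.span (Set.range q)) k * (expLT n s).card := by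
  classical
  have hfin := finite_quotient_trunc (Ideal.span (Set.range q)) k
  let b := Module.finBasis ℂ
    (MvPolynomial (Fin n) ℂ ⧸ (Ideal.span (Set.range q) ⊔ weightIdeal 1 k))
  choose e he using fun l => Ideal.Quotient.mkₐ_surjective ℂ
    (Ideal.span (Set.range q) ⊔ weightIdeal 1 k) (b l)
  have he' : ∀ f, ∃ c : Fin _ → ℂ,
      f - ∑ l, c l • e l ∈ Ideal.span (Set.range q) ⊔ weightIdeal 1 k := by
    intro f
    set y := Ideal.Quotient.mkₐ ℂ (Ideal.span (Set.range q) ⊔ weightIdeal 1 k) f with hy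
    refine ⟨fun l => b.repr y l, ?_⟩
    rw [← Ideal.Quotient.eq_zero_iff_mem, ← Ideal.Quotient.mkₐ_eq_mk ℂ, map_sub, map_sum]
    simp_rw [map_smul, he]
    rw [b.sum_repr y, hy, sub_self]
  have hspan := exists_sub_mem_powIdeal q k e he' s
  set π := Ideal.Quotient.mkₐ ℂ (powIdeal q s ⊔ weightIdeal 1 k) with hπ
  have htop : Submodule.span ℂ (Set.range fun p : Fin (Module.finrank ℂ
      (MvPolynomial (Fin n) ℂ ⧸ (Ideal.span (Set.range q) ⊔ weightIdeal 1 k))) × expLT n s =>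
        π (e p.1 * sysPow q p.2)) = ⊤ := by
    refine eq_top_iff.2 fun x _ => ?_
    obtain ⟨f, rfl⟩ := Ideal.Quotient.mkₐ_surjective ℂ _ x
    obtain ⟨v, hv, hfv⟩ := hspan f
    have h1 : π f = π v := Ideal.Quotient.eq.2 hfv
    have h2 := Submodule.mem_map_of_mem (f := π.toLinearMap) hv
    rw [Submodule.map_span, ← Set.range_comp] at h2
    change π f ∈ _
    rw [h1]
    exact h2
  have h1 := finrank_range_le_card (R := ℂ) (fun p : Fin (Module.finrank ℂ
      (MvPolynomial (Fin n) ℂ ⧸ (Ideal.span (Set.range q) ⊔ weightIdeal 1 k))) × expLT n s =>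
        π (e p.1 * sysPow q p.2))
  rw [Set.finrank, htop, finrank_top, Fintype.card_prod, Fintype.card_fin, Fintype.card_coe] at h1
  exact h1

/-- Exponents which do not occur in the elements of an ideal give independent monomials. -/
lemma card_le_finrank_of_coeff_eq_zero (I : Ideal (MvPolynomial (Fin n) ℂ))
    [Module.Finite ℂ (MvPolynomial (Fin n) ℂ ⧸ I)] (B : Finset (Fin n →₀ ℕ))
    (hB : ∀ f ∈ I, ∀ α ∈ B, coeff α f = 0) :
    B.card ≤ Module.finrank ℂ (MvPolynomial (Fin n) ℂ ⧸ I) := by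
  classical
  have hind : LinearIndependent ℂ
      (fun α : B => Ideal.Quotient.mkₐ ℂ I (monomial (α : Fin n →₀ ℕ) 1)) := by
    rw [Fintype.linearIndependent_iff]
    intro c hc α
    have h1 : ∑ β : B, monomial (β : Fin n →₀ ℕ) (c β) ∈ I := by
      rw [← Ideal.Quotient.eq_zero_iff_mem, ← Ideal.Quotient.mkₐ_eq_mk ℂ, map_sum, ← hc]
      refine Finset.sum_congr rfl fun γ _ => ?_
      rw [← map_smul, smul_monomial, smul_eq_mul, mul_one]
    have h2 := hB _ h1 α α.2
    rw [coeff_sum, Finset.sum_eq_single α] at h2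
    · simpa using h2
    · intro β _ hβ
      rw [coeff_monomial, if_neg fun h => hβ (Subtype.ext h)]
    · simp
  have := hind.fintype_card_le_finrank
  rwa [Fintype.card_coe] at this

/-- If the equations have order at least `a` and `b` for two weights, then the exponents which are
too small for the `s`-th power in one of the weights are bounded in number by the length of
that power. -/
lemma card_le_of_weights {q : SquareSystem n} {w₁ w₂ : Fin n → ℕ} {a b D : ℕ}
    (h₁ : ∀ i, q i ∈ weightIdeal w₁ a) (h₂ : ∀ i, q i ∈ weightIdeal w₂ b)
    (hD : ∀ k, truncLength (Ideal.span (Set.range q)) k ≤ D) (s : ℕ) (B : Finset (Fin n →₀ ℕ))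
    (hB : ∀ α ∈ B, Finsupp.weight w₁ α < a * s ∨ Finsupp.weight w₂ α < b * s) :
    B.card ≤ D * (expLT n s).card := by
  set k := B.sup Finsupp.degree + 1 with hk
  have hfin := finite_quotient_trunc (powIdeal q s) k
  have h := card_le_finrank_of_coeff_eq_zero (powIdeal q s ⊔ weightIdeal 1 k) B (by
    intro f hf α hα
    obtain ⟨g, hg, r, hr, rfl⟩ := Submodule.mem_sup.1 hf
    have hα1 : α.degree < k := Nat.lt_succ_of_le (Finset.le_sup (f := Finsupp.degree) hα)
    have hr0 : coeff α r = 0 := by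
      by_contra h0
      exact absurd (mem_weightIdeal_one.1 hr α h0) (not_le.2 hα1)
    have hg0 : coeff α g = 0 := by
      by_contra h0
      have h3 := powIdeal_le_weightIdeal h₁ s hg α h0
      have h4 := powIdeal_le_weightIdeal h₂ s hg α h0
      have := hB α hα
      omega
    rw [coeff_add, hr0, hg0, add_zero])
  exact h.trans ((finrank_powIdeal_le q k s).trans (Nat.mul_le_mul_right _ (hD k)))

/-! ### Counting exponents -/

lemma card_expLT_succ_le (m t : ℕ) :
    (expLT (m + 1) (t + 1)).card ≤ (expLT (m + 1) t).card + (t + 1) ^ m := by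
  classical
  have h1 : expLT (m + 1) (t + 1) ⊆
      expLT (m + 1) t ∪ (expLT (m + 1) (t + 1)).filter (fun α => α.degree = t) := by
    intro α hα
    have := mem_expLT.1 hα
    rw [Finset.mem_union, Finset.mem_filter, mem_expLT]
    by_cases h : α.degree < t
    · exact Or.inl h
    · exact Or.inr ⟨hα, by omega⟩
  refine (Finset.card_le_card h1).trans ((Finset.card_union_le _ _).trans ?_)
  refine Nat.add_le_add_left ?_ _
  have h2 : ((expLT (m + 1) (t + 1)).filter (fun α => α.degree = t)).card ≤
      (Fintype.piFinset fun _ : Fin m => Finset.range (t + 1)).card := by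
    refine Finset.card_le_card_of_injOn (fun α i => α (Fin.succ i)) ?_ ?_
    · intro α hα
      have hα' := (Finset.mem_filter.1 (Finset.mem_coe.1 hα)).2
      refine Finset.mem_coe.2 (Fintype.mem_piFinset.2 fun i => Finset.mem_range.2 ?_)
      have := Finsupp.le_degree (Fin.succ i) α
      change α i.succ < t + 1
      omega
    · intro α hα β hβ hαβ
      have hα' := (Finset.mem_filter.1 (Finset.mem_coe.1 hα)).2
      have hβ' := (Finset.mem_filter.1 (Finset.mem_coe.1 hβ)).2
      rw [Finsupp.degree_eq_sum, Fin.sum_univ_succ] at hα' hβ'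
      have h3 : ∀ i : Fin m, α i.succ = β i.succ := fun i => congrFun hαβ i
      have h4 : ∑ i : Fin m, α i.succ = ∑ i : Fin m, β i.succ :=
        Finset.sum_congr rfl fun i _ => h3 i
      ext j
      refine Fin.cases ?_ h3 j
      omega
  simpa using h2

lemma card_expLT_le (m s κ : ℕ) :
    (expLT (m + 1) s).card ≤ (expLT (m + 1) (s - κ)).card + κ * s ^ m := by
  induction κ with
  | zero => simp
  | succ κ ih =>
    rcases Nat.eq_zero_or_pos (s - κ) with h | h
    · have h1 : s - (κ + 1) = s - κ := by omega
      rw [h1, Nat.succ_mul]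
      omega
    · obtain ⟨t, ht⟩ := Nat.exists_eq_succ_of_ne_zero h.ne'
      have h1 : s - (κ + 1) = t := by omega
      have h2 := card_expLT_succ_le m t
      have h3 : (t + 1) ^ m ≤ s ^ m := Nat.pow_le_pow_left (by omega) m
      rw [h1, Nat.succ_mul]
      rw [ht] at ih
      have h4 : (expLT (m + 1) t.succ).card = (expLT (m + 1) (t + 1)).card := rfl
      omega

lemma pow_le_card_expLT (n r : ℕ) : (r + 1) ^ n ≤ (expLT n (n * r + 1)).card := by
  classical
  have h : (Fintype.piFinset fun _ : Fin n => Finset.range (r + 1)).card ≤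
      (expLT n (n * r + 1)).card := by
    refine Finset.card_le_card_of_injOn (fun p => Finsupp.equivFunOnFinite.symm p) ?_ ?_
    · intro p hp
      have hp' := Fintype.mem_piFinset.1 (Finset.mem_coe.1 hp)
      refine Finset.mem_coe.2 (mem_expLT.2 ?_)
      change Finsupp.degree (Finsupp.equivFunOnFinite.symm p) < _
      rw [Finsupp.degree_eq_sum]
      have h1 : ∑ i, (Finsupp.equivFunOnFinite.symm p : Fin n →₀ ℕ) i ≤ ∑ _i : Fin n, r :=
        Finset.sum_le_sum fun i _ => Nat.lt_succ_iff.1 (Finset.mem_range.1 (hp' i))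
      simp only [Finset.sum_const, Finset.card_univ, Fintype.card_fin, smul_eq_mul] at h1
      omega
    · exact fun p _ p' _ h => Finsupp.equivFunOnFinite.symm.injective h
  simpa using h

/-- The weight adapted to systems whose initial forms vanish on the axis of the variable `i₀`: it
is `1` at `i₀`, `2` at the other variables among the first `κ`, and `d + 1` elsewhere. -/
def axisWeight (κ d : ℕ) (i₀ : Fin n) : Fin n → ℕ :=
  fun i => if i = i₀ then 1 else if (i : ℕ) < κ then 2 else d + 1

open Classical in
/-- The exponents with the entries `d * u i + r i`, `r i < d`, at the first `κ` places and `u i` at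
the others, for the exponents `u` of degree less than `t`. Each exponent comes from only one pair
`(r, u)`, and its block weight is about `d` times the degree of `u`. -/
def scaledExponents (n κ d t : ℕ) : Finset (Fin n →₀ ℕ) :=
  ((Fintype.piFinset fun _ : Fin κ => Finset.range d) ×ˢ expLT n t).image fun p =>
    Finsupp.equivFunOnFinite.symm fun i : Fin n =>
      if h : (i : ℕ) < κ then d * p.2 i + p.1 ⟨i, h⟩ else p.2 i

lemma card_scaledExponents {κ : ℕ} (hκ : κ ≤ n) (d t : ℕ) :
    (scaledExponents n κ d t).card = d ^ κ * (expLT n t).card := by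
  classical
  rw [scaledExponents, Finset.card_image_of_injOn]
  · simp
  · rintro ⟨r, u⟩ hp ⟨r', u'⟩ hp' h
    have hr := Fintype.mem_piFinset.1 (Finset.mem_product.1 (Finset.mem_coe.1 hp)).1
    have hr' := Fintype.mem_piFinset.1 (Finset.mem_product.1 (Finset.mem_coe.1 hp')).1
    have h1 := Finsupp.equivFunOnFinite.symm.injective h
    have h2 : ∀ (i : Fin n) (hi : (i : ℕ) < κ), d * u i + r ⟨i, hi⟩ = d * u' i + r' ⟨i, hi⟩ := by
      intro i hi
      have := congrFun h1 i
      simpa [hi] using this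
    have hmod : ∀ (i : Fin n) (hi : (i : ℕ) < κ), r ⟨i, hi⟩ = r' ⟨i, hi⟩ := by
      intro i hi
      have h3 := congrArg (· % d) (h2 i hi)
      simp only [Nat.mul_add_mod] at h3
      rwa [Nat.mod_eq_of_lt (Finset.mem_range.1 (hr _)),
        Nat.mod_eq_of_lt (Finset.mem_range.1 (hr' _))] at h3
    refine Prod.ext (funext fun i => ?_) (Finsupp.ext fun i => ?_)
    · exact hmod (Fin.castLE hκ i) i.2
    · by_cases hi : (i : ℕ) < κ
      · have h3 := h2 i hi
        rw [hmod i hi] at h3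
        have hd : 0 < d := lt_of_le_of_lt (Nat.zero_le _) (Finset.mem_range.1 (hr ⟨i, hi⟩))
        exact Nat.eq_of_mul_eq_mul_left hd (Nat.add_right_cancel h3)
      · have := congrFun h1 i
        simpa [hi] using this

lemma weight_lt_of_mem_scaledExponents {κ d s : ℕ} (hκ : 1 ≤ κ) {α : Fin n →₀ ℕ}
    (hα : α ∈ scaledExponents n κ d (s - κ)) :
    Finsupp.weight (blockWeight κ d) α < d * s := by
  classical
  rw [scaledExponents, Finset.mem_image] at hα
  obtain ⟨⟨r, u⟩, hp, rfl⟩ := hα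
  obtain ⟨hr, hu⟩ := Finset.mem_product.1 hp
  have hr : ∀ i, r i ∈ Finset.range d := Fintype.mem_piFinset.1 hr
  have hu : u.degree < s - κ := mem_expLT.1 hu
  have hd : 0 < d := lt_of_le_of_lt (Nat.zero_le _) (Finset.mem_range.1 (hr ⟨0, hκ⟩))
  have h1 : Finsupp.weight (blockWeight κ d) (Finsupp.equivFunOnFinite.symm fun i : Fin n =>
      if h : (i : ℕ) < κ then d * u i + r ⟨i, h⟩ else u i) ≤
      ∑ i : Fin n, (d * u i + if (i : ℕ) < κ then d else 0) := by
    rw [Finsupp.weight_eq_sum]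
    refine Finset.sum_le_sum fun i _ => ?_
    by_cases hi : (i : ℕ) < κ
    · have := Finset.mem_range.1 (hr ⟨i, hi⟩)
      simp only [Finsupp.coe_equivFunOnFinite_symm, hi, dif_pos, blockWeight, if_true, smul_eq_mul,
        mul_one]
      omega
    · simp [hi, blockWeight, mul_comm]
  refine lt_of_le_of_lt h1 ?_
  rw [Finset.sum_add_distrib, ← Finset.mul_sum, ← Finsupp.degree_eq_sum, ← Finset.sum_filter,
    Finset.sum_const, Fin.card_filter_val_lt, smul_eq_mul]
  have h2 : min n κ * d ≤ d * κ := by rw [mul_comm]; exact Nat.mul_le_mul_left _ (min_le_right _ _)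
  have h3 : d * u.degree + d * κ < d * s := by
    rw [← mul_add]
    exact Nat.mul_lt_mul_of_pos_left (by omega) hd
  omega

/-- The exponents near the point `c` of the axis of `i₀`: the sums of this point and an exponent of
degree less than `t`. -/
def vertexExponents (n : ℕ) (i₀ : Fin n) (c t : ℕ) : Finset (Fin n →₀ ℕ) :=
  (expLT n t).map (addLeftEmbedding (Finsupp.single i₀ c))

lemma mem_vertexExponents {i₀ : Fin n} {κ d s m : ℕ} (hi₀ : (i₀ : ℕ) < κ)
    (hs : (d + 2) * m ≤ s) {α : Fin n →₀ ℕ} (hα : α ∈ vertexExponents n i₀ (d * s) m) :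
    d * s ≤ Finsupp.weight (blockWeight κ d) α ∧
      Finsupp.weight (axisWeight κ d i₀) α < (d + 1) * s := by
  rw [vertexExponents, Finset.mem_map] at hα
  obtain ⟨u, hu, rfl⟩ := hα
  have hu := mem_expLT.1 hu
  rw [addLeftEmbedding_apply, map_add, map_add, Finsupp.weight_single, Finsupp.weight_single]
  constructor
  · simp [blockWeight, hi₀]
  · have h1 : Finsupp.weight (axisWeight κ d i₀) u ≤ (d + 2) * u.degree := by
      rw [Finsupp.weight_eq_sum, Finsupp.degree_eq_sum, Finset.mul_sum]
      refine Finset.sum_le_sum fun i _ => ?_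
      rw [smul_eq_mul, mul_comm]
      refine Nat.mul_le_mul_right _ ?_
      rw [axisWeight]
      split_ifs <;> omega
    have h2 : (d + 2) * u.degree < s :=
      lt_of_lt_of_le (Nat.mul_lt_mul_of_pos_left hu (by omega)) hs
    simp only [axisWeight, if_true, smul_eq_mul, mul_one]
    rw [Nat.succ_mul]
    omega

/-- The exponents of small weight outnumber `d ^ κ` times the exponents of degree less than `s`:
those of block weight less than `d * s` already match this number to leading order, and those near
the vertex `d * s` of the axis of `i₀` contribute another positive multiple of `s ^ n`. -/
lemma exists_card_lt {κ : ℕ} (hκ : κ ≤ n) (d : ℕ) {i₀ : Fin n} (hi₀ : (i₀ : ℕ) < κ) :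
    ∃ (s : ℕ) (B : Finset (Fin n →₀ ℕ)),
      (∀ α ∈ B, Finsupp.weight (blockWeight κ d) α < d * s ∨
        Finsupp.weight (axisWeight κ d i₀) α < (d + 1) * s) ∧
      d ^ κ * (expLT n s).card < B.card := by
  classical
  obtain ⟨m, rfl⟩ : ∃ m, n = m + 1 := ⟨n - 1, by have := i₀.2; omega⟩
  -- the scaled exponents fall short of the required number by at most `C * (C + 1) ^ m`, and there
  -- are at least `(C + 1) ^ (m + 1)` exponents near the vertex
  set C := d ^ κ * (κ * ((d + 2) * (m + 2)) ^ m) with hC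
  set t := (m + 1) * C + 1 with ht
  set s := (d + 2) * t with hs
  have hdisj : Disjoint (scaledExponents (m + 1) κ d (s - κ))
      (vertexExponents (m + 1) i₀ (d * s) t) := by
    rw [Finset.disjoint_left]
    intro α h1 h2
    have h3 := weight_lt_of_mem_scaledExponents (by omega) h1
    have h4 := (mem_vertexExponents (s := s) hi₀ hs.ge h2).1
    omega
  refine ⟨s, scaledExponents (m + 1) κ d (s - κ) ∪ vertexExponents (m + 1) i₀ (d * s) t,
    fun α hα => ?_, ?_⟩
  · rcases Finset.mem_union.1 hα with h | h
    · exact Or.inl (weight_lt_of_mem_scaledExponents (by omega) h)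
    · exact Or.inr (mem_vertexExponents (s := s) hi₀ hs.ge h).2
  · rw [Finset.card_union_of_disjoint hdisj, card_scaledExponents hκ, vertexExponents,
      Finset.card_map]
    have h1 := Nat.mul_le_mul_left (d ^ κ) (card_expLT_le m s κ)
    have h2 : (C + 1) ^ (m + 1) ≤ (expLT (m + 1) t).card := pow_le_card_expLT (m + 1) C
    have h3 : s ^ m ≤ ((d + 2) * (m + 2)) ^ m * (C + 1) ^ m := by
      rw [← mul_pow]
      refine Nat.pow_le_pow_left ?_ m
      rw [hs, ht, mul_assoc]
      refine Nat.mul_le_mul_left _ ?_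
      nlinarith [Nat.zero_le (m * 1), Nat.zero_le C]
    have h4 : d ^ κ * (κ * s ^ m) ≤ C * (C + 1) ^ m := by
      rw [hC, mul_assoc, mul_assoc]
      exact Nat.mul_le_mul_left _ (Nat.mul_le_mul_left _ h3)
    have h5 : C * (C + 1) ^ m < (C + 1) ^ (m + 1) := by
      rw [pow_succ, mul_comm]
      exact Nat.mul_lt_mul_of_pos_left (Nat.lt_succ_self C) (by positivity)
    rw [mul_add] at h1
    omega

/-! ### The initial forms have no common zero -/

lemma le_weight_of_not_pure {κ c : ℕ} {α : Fin n →₀ ℕ} (h : ¬ IsPure κ α) :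
    c ≤ Finsupp.weight (blockWeight κ c) α := by
  rw [IsPure] at h
  push Not at h
  obtain ⟨j, hj, hj0⟩ := h
  have h1 := Finsupp.le_weight_of_ne_zero' (blockWeight κ c) hj0
  simpa [blockWeight, not_lt.2 hj] using h1

lemma mem_weightIdeal_blockWeight {κ c : ℕ} {f : MvPolynomial (Fin n) ℂ}
    (h : ∀ α, coeff α f ≠ 0 → IsPure κ α → c ≤ α.degree) :
    f ∈ weightIdeal (blockWeight κ c) c := by
  intro α hα
  by_cases hp : IsPure κ α
  · rw [hp.weight_eq]
    exact h α hα hp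
  · exact le_weight_of_not_pure hp

lemma eval_smul_of_isHomogeneous {f : MvPolynomial (Fin n) ℂ} {d : ℕ} (hf : f.IsHomogeneous d)
    (c : ℂ) (x : Fin n → ℂ) : eval (c • x) f = c ^ d * eval x f := by
  rw [eval_eq', eval_eq', Finset.mul_sum]
  refine Finset.sum_congr rfl fun α hα => ?_
  have h1 : ∑ i, α i = d := by
    rw [← Finsupp.degree_eq_sum, Finsupp.degree_eq_weight_one]
    exact hf (mem_support_iff.1 hα)
  simp only [Pi.smul_apply, smul_eq_mul, mul_pow, Finset.prod_mul_distrib]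
  rw [Finset.prod_pow_eq_pow_sum, h1]
  ring

lemma exists_ne_zero_of_ne_single {α : Fin n →₀ ℕ} {d : ℕ} {i₀ : Fin n} (hd : α.degree = d)
    (hne : α ≠ Finsupp.single i₀ d) : ∃ j, j ≠ i₀ ∧ α j ≠ 0 := by
  by_contra h
  push Not at h
  apply hne
  have h3 : α = Finsupp.single i₀ (α i₀) := by
    ext j
    by_cases hj : j = i₀
    · subst hj; simp
    · simp [h j hj, Ne.symm hj]
  rw [h3, Finsupp.degree_single] at hd
  rw [h3, hd]

/-- The coefficient of a form at the `d`-th power of a variable is its value at the corresponding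
basis vector. -/
lemma eval_single_of_isHomogeneous {f : MvPolynomial (Fin n) ℂ} {d : ℕ} (hf : f.IsHomogeneous d)
    (i₀ : Fin n) : eval (Pi.single i₀ 1) f = coeff (Finsupp.single i₀ d) f := by
  classical
  rw [eval_eq']
  have key : ∀ α ∈ f.support, α ≠ Finsupp.single i₀ d →
      coeff α f * ∏ i, (Pi.single i₀ (1 : ℂ) : Fin n → ℂ) i ^ α i = 0 := by
    intro α hα hne
    have h1 : α.degree = d := by
      rw [Finsupp.degree_eq_weight_one]
      exact hf (mem_support_iff.1 hα)
    have h2 := exists_ne_zero_of_ne_single h1 hne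
    obtain ⟨j, hj, hj0⟩ := h2
    rw [Finset.prod_eq_zero (Finset.mem_univ j), mul_zero]
    rw [Pi.single_eq_of_ne hj, zero_pow hj0]
  by_cases hmem : Finsupp.single i₀ d ∈ f.support
  · rw [Finset.sum_eq_single_of_mem _ hmem key, Finset.prod_eq_one, mul_one]
    intro i _
    by_cases hi : i = i₀
    · subst hi; simp
    · simp [Ne.symm hi]
  · rw [notMem_support_iff.1 hmem]
    exact Finset.sum_eq_zero fun α hα => key α hα fun h => hmem (h ▸ hα)

/-- If the lengths of all truncations of a system in normal form are at most `d ^ κ` and the first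
`κ` equations have order at least `d`, then their forms of degree `d` have no common zero apart
from the origin: after a linear change of variables a common zero lies on a coordinate axis, and
then the powers of the ideal avoid too many monomials. -/
lemma IsNormalForm.exists_eval_ne_zero {P : SquareSystem n} {κ d : ℕ} (hP : IsNormalForm P κ d)
    (hκ : κ ≤ n) (hord : ∀ i : Fin n, (i : ℕ) < κ → P i ∈ weightIdeal 1 d)
    (hlen : ∀ k, truncLength (Ideal.span (Set.range P)) k ≤ d ^ κ)
    {a : Fin n → ℂ} (ha : ∀ j : Fin n, κ ≤ (j : ℕ) → a j = 0) (ha0 : a ≠ 0) :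
    ∃ i : Fin n, (i : ℕ) < κ ∧ eval a (homogeneousComponent d (P i)) ≠ 0 := by
  classical
  by_contra hcon
  push Not at hcon
  obtain ⟨i₀, hi₀⟩ : ∃ i₀, a i₀ ≠ 0 := by
    by_contra h
    push Not at h
    exact ha0 (funext h)
  have hi₀κ : (i₀ : ℕ) < κ := by
    by_contra h
    exact hi₀ (ha i₀ (not_lt.1 h))
  -- the shear which moves the `i₀`-th basis vector to a multiple of `a`
  set b : Fin n → ℂ := fun i => if i = i₀ then 0 else a i / a i₀ with hb
  have hb0 : ∀ j : Fin n, κ ≤ (j : ℕ) → b j = 0 := by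
    intro j hj
    simp [hb, ha j hj]
  set N : Matrix (Fin n) (Fin n) ℂ := Matrix.of fun i j => if j = i₀ then b i else 0 with hN
  have hNN : N * N = 0 := by
    ext i j
    rw [Matrix.mul_apply]
    refine Finset.sum_eq_zero fun k _ => ?_
    by_cases hk : k = i₀
    · subst hk; simp [hN, hb]
    · simp [hN, hk]
  have hunit : IsUnit (1 + N) := by
    refine IsUnit.of_mul_eq_one (1 - N) ?_
    rw [mul_sub, add_mul, add_mul, one_mul, one_mul, mul_one, hNN]
    simp
  set T : SquareSystem n := linearSystem (1 + N) with hT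
  have hTi : ∀ i, T i = X i + C (b i) * X i₀ := by
    intro i
    simp only [hT, linearSystem, Matrix.add_apply, map_add, add_mul, Finset.sum_add_distrib]
    congr 1
    · rw [Finset.sum_eq_single i]
      · simp
      · intro j _ hj; simp [hj.symm]
      · simp
    · rw [Finset.sum_eq_single i₀]
      · simp [hN]
      · intro j _ hj; simp [hN, hj]
      · simp
  have hTw : ∀ c i, T i ∈ weightIdeal (blockWeight κ c) (blockWeight κ c i) := by
    intro c i
    rw [hTi]
    by_cases hi : (i : ℕ) < κ
    · refine add_mem (X_mem_weightIdeal le_rfl) (C_mul_mem_weightIdeal _ (X_mem_weightIdeal ?_))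
      simp [blockWeight, hi, hi₀κ]
    · rw [hb0 i (not_lt.1 hi)]
      simpa using X_mem_weightIdeal le_rfl
  have hTpt : polyMap T (Pi.single i₀ 1) = (a i₀)⁻¹ • a := by
    funext i
    by_cases hi : i = i₀
    · subst hi
      simp [polyMap, hTi, hb, hi₀]
    · simp [polyMap, hTi, hb, hi, div_eq_inv_mul]
  have hle : LocallyEquivalent P (comp P T) :=
    LocallyEquivalent.of_comp (polyMap_linearSystem_zero _)
      (by rw [hT, jacobian_linearSystem_zero]; exact hunit)
  have h₁ : ∀ i, comp P T i ∈ weightIdeal (blockWeight κ d) d := by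
    intro i
    refine bind₁_mem_weightIdeal (hTw d) (mem_weightIdeal_blockWeight fun α hα hp => ?_)
    by_cases hi : (i : ℕ) < κ
    · exact mem_weightIdeal_one.1 (hord i hi) α hα
    · exact (hP.pure_high i (not_lt.1 hi) α hα hp).le
  have hax : ∀ i, blockWeight κ (d + 1) i ≤ axisWeight κ d i₀ i := by
    intro i
    by_cases hi : i = i₀
    · subst hi; simp [blockWeight, axisWeight, hi₀κ]
    · by_cases hi' : (i : ℕ) < κ <;> simp [blockWeight, axisWeight, hi, hi']
  have hform : ∀ i : Fin n, (i : ℕ) < κ →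
      bind₁ T (homogeneousComponent d (P i)) ∈ weightIdeal (axisWeight κ d i₀) (d + 1) := by
    intro i hi α hα
    have hhom : (bind₁ T (homogeneousComponent d (P i))).IsHomogeneous d := by
      have h1 := (homogeneousComponent_isHomogeneous d (P i)).aeval T (n := 1) (fun j => by
        rw [hTi]
        exact (isHomogeneous_X _ _).add ((isHomogeneous_C _ _).mul (isHomogeneous_X _ _)))
      simpa using h1
    have hdeg : α.degree = d := by
      rw [Finsupp.degree_eq_weight_one]
      exact hhom hα
    have hne : α ≠ Finsupp.single i₀ d := by
      rintro rfl
      apply hα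
      rw [← eval_single_of_isHomogeneous hhom, eval_bind₁_eq, hTpt,
        eval_smul_of_isHomogeneous (homogeneousComponent_isHomogeneous d (P i)), hcon i hi,
        mul_zero]
    have hex := exists_ne_zero_of_ne_single hdeg hne
    obtain ⟨j, hj, hj0⟩ := hex
    have hd : 1 ≤ d := by
      have := Finsupp.le_degree j α
      omega
    rw [Finsupp.weight_eq_sum, ← Finset.add_sum_erase _ _ (Finset.mem_univ j)]
    rw [Finsupp.degree_eq_sum, ← Finset.add_sum_erase _ _ (Finset.mem_univ j)] at hdeg
    have h4 : ∑ i ∈ Finset.univ.erase j, α i ≤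
        ∑ i ∈ Finset.univ.erase j, α i • axisWeight κ d i₀ i := by
      refine Finset.sum_le_sum fun i _ => ?_
      rw [smul_eq_mul]
      refine Nat.le_mul_of_pos_right _ ?_
      rw [axisWeight]
      split_ifs <;> omega
    have h5 : α j + 1 ≤ α j • axisWeight κ d i₀ j := by
      have h6 : 2 ≤ axisWeight κ d i₀ j := by
        rw [axisWeight, if_neg hj]
        split_ifs <;> omega
      have h7 := Nat.mul_le_mul_left (α j) h6
      rw [smul_eq_mul]
      omega
    omega
  have h₂ : ∀ i, comp P T i ∈ weightIdeal (axisWeight κ d i₀) (d + 1) := by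
    intro i
    by_cases hi : (i : ℕ) < κ
    · have h1 : P i - homogeneousComponent d (P i) ∈
          weightIdeal (blockWeight κ (d + 1)) (d + 1) := by
        refine mem_weightIdeal_blockWeight fun α hα _ => ?_
        rw [coeff_sub, coeff_homogeneousComponent] at hα
        by_cases hd : α.degree = d
        · simp [hd] at hα
        · rw [if_neg hd, sub_zero] at hα
          have := mem_weightIdeal_one.1 (hord i hi) α hα
          omega
      have h2 := add_mem (weightIdeal_mono hax _ (bind₁_mem_weightIdeal (hTw _) h1)) (hform i hi)
      rwa [map_sub, sub_add_cancel] at h2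
    · refine weightIdeal_mono hax _ (bind₁_mem_weightIdeal (hTw _)
        (mem_weightIdeal_blockWeight fun α hα hp => ?_))
      exact hP.pure_high i (not_lt.1 hi) α hα hp
  obtain ⟨s, B, hB, hcard⟩ := exists_card_lt hκ d hi₀κ
  exact absurd (card_le_of_weights h₁ h₂ (fun k => (hle.truncLength_eq k).trans_le (hlen k)) s B hB)
    (not_le.2 hcard)

/-! ### Regular sequences in an ideal generated by a vector space -/

section Regular

variable {K S : Type*} [Field K] [CommRing S] [Algebra K S]

/-- The element `g` is a nonzerodivisor modulo the ideal `N`. -/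
def IsRegularMod {S : Type*} [CommRing S] (N : Ideal S) (g : S) : Prop := ∀ m, g * m ∈ N → m ∈ N

/-- The ideal `I` kills no nonzero element modulo `N`. -/
def HasNoSocle {S : Type*} [CommRing S] (I N : Ideal S) : Prop :=
  ∀ m, (∀ i ∈ I, i * m ∈ N) → m ∈ N

/-- The ideal `I` contains a weakly regular sequence of length `r` on the quotient by `N`. -/
def DepthGE {S : Type*} [CommRing S] (I : Ideal S) : ℕ → Ideal S → Prop
  | 0, _ => True
  | r + 1, N => ∃ g ∈ I, IsRegularMod N g ∧ DepthGE I r (N ⊔ Ideal.span {g})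

lemma IsRegularMod.hasNoSocle {I N : Ideal S} {g : S} (hg : g ∈ I) (h : IsRegularMod N g) :
    HasNoSocle I N := fun m hm => h m (hm g hg)

lemma isRegularMod_iff {N : Ideal S} {g : S} : IsRegularMod N g ↔ IsSMulRegular (S ⧸ N) g := by
  rw [isSMulRegular_iff_right_eq_zero_of_smul]
  constructor
  · intro h x hx
    obtain ⟨m, rfl⟩ := Ideal.Quotient.mk_surjective x
    rw [Algebra.smul_def, Ideal.Quotient.algebraMap_eq, ← map_mul,
      Ideal.Quotient.eq_zero_iff_mem] at hx
    exact Ideal.Quotient.eq_zero_iff_mem.2 (h m hx)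
  · intro h m hm
    refine Ideal.Quotient.eq_zero_iff_mem.1 (h (Ideal.Quotient.mk N m) ?_)
    rw [Algebra.smul_def, Ideal.Quotient.algebraMap_eq, ← map_mul,
      Ideal.Quotient.eq_zero_iff_mem]
    exact hm

/-- If `I` kills nothing modulo `N`, then no associated prime of `S ⧸ N` contains `I`. -/
lemma not_le_of_mem_associatedPrimes [IsNoetherianRing S] {I N p : Ideal S}
    (h : HasNoSocle I N) (hp : p ∈ associatedPrimes S (S ⧸ N)) : ¬ I ≤ p := by
  intro hle
  obtain ⟨hprime, x, rfl⟩ := isAssociatedPrime_iff.1 hp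
  obtain ⟨m, rfl⟩ := Ideal.Quotient.mk_surjective x
  have hm : m ∈ N := by
    refine h m fun i hi => ?_
    have h1 := Submodule.mem_colon_singleton.1 (hle hi)
    rw [Submodule.mem_bot, Algebra.smul_def, Ideal.Quotient.algebraMap_eq, ← map_mul,
      Ideal.Quotient.eq_zero_iff_mem] at h1
    exact h1
  apply hprime.ne_top
  rw [Ideal.eq_top_iff_one, Submodule.mem_colon_singleton, Ideal.Quotient.eq_zero_iff_mem.2 hm,
    smul_zero]
  exact zero_mem _

/-- A vector space generating `I` contains an element which is regular modulo finitely many given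
ideals modulo which `I` kills nothing. -/
lemma exists_mem_isRegularMod [Infinite K] [IsNoetherianRing S] (V : Submodule K S)
    (s : Finset (Ideal S))
    (hs : ∀ N ∈ s, HasNoSocle (Ideal.span (V : Set S)) N) :
    ∃ u ∈ V, ∀ N ∈ s, IsRegularMod N u := by
  classical
  let A : Finset (Ideal S) := s.biUnion fun N => (associatedPrimes.finite S (S ⧸ N)).toFinset
  let t : Finset (Submodule K V) :=
    A.image fun p => (p.restrictScalars K).comap V.subtype
  have ht : (⊤ : Submodule K V) ∉ t := by
    intro h
    obtain ⟨p, hp, htop⟩ := Finset.mem_image.1 h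
    obtain ⟨N, hN, hpN⟩ := Finset.mem_biUnion.1 hp
    refine not_le_of_mem_associatedPrimes (hs N hN) ((Set.Finite.mem_toFinset _).1 hpN) ?_
    refine Ideal.span_le.2 fun v hv => ?_
    have h1 : (⟨v, hv⟩ : V) ∈ (p.restrictScalars K).comap V.subtype := by
      rw [htop]; trivial
    exact h1
  have hne := Subspace.biUnion_ne_univ_of_top_notMem ht
  obtain ⟨u, hu⟩ := (Set.ne_univ_iff_exists_notMem _).1 hne
  refine ⟨u, u.2, fun N hN => ?_⟩
  rw [isRegularMod_iff]
  by_contra hnot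
  have h1 : (u : S) ∈ ⋃ p ∈ associatedPrimes S (S ⧸ N), (p : Set S) := by
    rw [biUnion_associatedPrimes_eq_compl_regular]
    exact hnot
  simp only [Set.mem_iUnion] at h1
  obtain ⟨p, hp, hup⟩ := h1
  refine hu (Set.mem_biUnion (x := (p.restrictScalars K).comap V.subtype) ?_ hup)
  exact Finset.mem_coe.2 (Finset.mem_image_of_mem _
    (Finset.mem_biUnion.2 ⟨N, hN, (Set.Finite.mem_toFinset _).2 hp⟩))

lemma mem_sup_span_singleton' {N : Ideal S} {g m : S} :
    m ∈ N ⊔ Ideal.span {g} ↔ ∃ x ∈ N, ∃ c, x + g * c = m := by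
  rw [Submodule.mem_sup]
  constructor
  · rintro ⟨x, hx, y, hy, rfl⟩
    obtain ⟨c, rfl⟩ := Ideal.mem_span_singleton'.1 hy
    exact ⟨x, hx, c, by ring⟩
  · rintro ⟨x, hx, c, rfl⟩
    exact ⟨x, hx, g * c, Ideal.mul_mem_right _ _ (Ideal.mem_span_singleton_self g), rfl⟩

/-- Whether `I` kills something modulo a regular element does not depend on the element. -/
lemma HasNoSocle.swap {I N : Ideal S} {g h : S} (hgI : g ∈ I) (hg : IsRegularMod N g)
    (hh : IsRegularMod N h) (H : HasNoSocle I (N ⊔ Ideal.span {g})) :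
    HasNoSocle I (N ⊔ Ideal.span {h}) := by
  intro m hm
  obtain ⟨n₀, hn₀, m', hm'⟩ := mem_sup_span_singleton'.1 (hm g hgI)
  have h1 : m' ∈ N ⊔ Ideal.span {g} := by
    refine H m' fun i hi => ?_
    obtain ⟨n₁, hn₁, c, hc⟩ := mem_sup_span_singleton'.1 (hm i hi)
    have h2 : h * (i * m' - g * c) ∈ N := by
      have h3 : h * (i * m' - g * c) = g * n₁ - i * n₀ := by
        linear_combination i * hm' - g * hc
      rw [h3]
      exact sub_mem (Ideal.mul_mem_left _ _ hn₁) (Ideal.mul_mem_left _ _ hn₀)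
    exact mem_sup_span_singleton'.2 ⟨_, hh _ h2, c, by ring⟩
  obtain ⟨n₂, hn₂, e, he⟩ := mem_sup_span_singleton'.1 h1
  have h4 : g * (m - h * e) ∈ N := by
    have h5 : g * (m - h * e) = n₀ + h * n₂ := by
      linear_combination -hm' - h * he
    rw [h5]
    exact add_mem hn₀ (Ideal.mul_mem_left _ _ hn₂)
  exact mem_sup_span_singleton'.2 ⟨_, hg _ h4, e, by ring⟩

/-- The half of the exchange of a regular sequence `g, u` for `u, g` which does not need `u` to be
regular modulo `N`. -/
lemma IsRegularMod.swap {N : Ideal S} {g u : S} (hg : IsRegularMod N g)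
    (hu : IsRegularMod (N ⊔ Ideal.span {g}) u) : IsRegularMod (N ⊔ Ideal.span {u}) g := by
  intro m hm
  obtain ⟨n₀, hn₀, m', hm'⟩ := mem_sup_span_singleton'.1 hm
  have h1 : u * m' ∈ N ⊔ Ideal.span {g} :=
    mem_sup_span_singleton'.2 ⟨-n₀, neg_mem hn₀, m, by linear_combination -hm'⟩
  obtain ⟨n₁, hn₁, c, hc⟩ := mem_sup_span_singleton'.1 (hu m' h1)
  have h2 : g * (m - u * c) ∈ N := by
    have h3 : g * (m - u * c) = n₀ + u * n₁ := by
      linear_combination -hm' - u * hc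
    rw [h3]
    exact add_mem hn₀ (Ideal.mul_mem_left _ _ hn₁)
  exact mem_sup_span_singleton'.2 ⟨_, hg _ h2, c, by ring⟩

/-- Any regular element of `I` can be the first one of a regular sequence of maximal length. -/
lemma DepthGE.sup_span_singleton [Infinite K] [IsNoetherianRing S] (V : Submodule K S) (r : ℕ)
    (N : Ideal S) {h : S}
    (hI : h ∈ Ideal.span (V : Set S)) (hh : IsRegularMod N h)
    (H : DepthGE (Ideal.span (V : Set S)) (r + 1) N) :
    DepthGE (Ideal.span (V : Set S)) r (N ⊔ Ideal.span {h}) := by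
  classical
  induction r generalizing N h with
  | zero => trivial
  | succ r ih =>
    obtain ⟨g, hgI, hg, H'⟩ := H
    obtain ⟨g₂, hg₂I, hg₂, -⟩ := id H'
    have hs1 := hg₂.hasNoSocle hg₂I
    have hs2 := hs1.swap hgI hg hh
    obtain ⟨u, huV, hu⟩ := exists_mem_isRegularMod V {N, N ⊔ Ideal.span {g}, N ⊔ Ideal.span {h}} (by
      intro N' hN'
      simp only [Finset.mem_insert, Finset.mem_singleton] at hN'
      rcases hN' with rfl | rfl | rfl
      · exact hg.hasNoSocle hgI
      · exact hs1
      · exact hs2)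
    have huI : u ∈ Ideal.span (V : Set S) := Ideal.subset_span huV
    have hu0 := hu N (by simp)
    have hu1 := hu (N ⊔ Ideal.span {g}) (by simp)
    have hu2 := hu (N ⊔ Ideal.span {h}) (by simp)
    have D1 := ih (N ⊔ Ideal.span {g}) huI hu1 H'
    have D2 : DepthGE (Ideal.span (V : Set S)) (r + 1) (N ⊔ Ideal.span {u}) :=
      ⟨g, hgI, hg.swap hu1, by rwa [sup_right_comm]⟩
    have D3 := ih (N ⊔ Ideal.span {u}) hI (hh.swap hu2) D2
    exact ⟨u, huI, hu2, by rwa [sup_right_comm]⟩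

/-- A regular sequence of maximal length can be chosen in any vector space of generators. -/
lemma DepthGE.exists_list [Infinite K] [IsNoetherianRing S] (V : Submodule K S) (r : ℕ)
    (N : Ideal S)
    (H : DepthGE (Ideal.span (V : Set S)) r N) :
    ∃ l : List S, l.length = r ∧ (∀ x ∈ l, x ∈ V) ∧
      ∀ i (hi : i < l.length), IsRegularMod (N ⊔ Ideal.ofList (l.take i)) l[i] := by
  induction r generalizing N with
  | zero => exact ⟨[], rfl, by simp, by simp⟩
  | succ r ih =>
    obtain ⟨g, hgI, hg, -⟩ := id H
    obtain ⟨h, hV, hh⟩ := exists_mem_isRegularMod V {N} (by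
      intro N' hN'
      rw [Finset.mem_singleton.1 hN']
      exact hg.hasNoSocle hgI)
    have hh := hh N (by simp)
    obtain ⟨l, hl, hlV, hreg⟩ := ih (N ⊔ Ideal.span {h})
      (DepthGE.sup_span_singleton V r N (Ideal.subset_span hV) hh H)
    refine ⟨h :: l, by simp [hl], ?_, ?_⟩
    · intro x hx
      rcases List.mem_cons.1 hx with rfl | hx
      · exact hV
      · exact hlV x hx
    · intro i hi
      cases i with
      | zero => simpa using hh
      | succ i =>
        have := hreg i (by simpa using hi)
        simpa [sup_assoc] using this

lemma isWeaklyRegular_of_isRegularMod {l : List S}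
    (h : ∀ i (hi : i < l.length), IsRegularMod (Ideal.ofList (l.take i)) l[i]) :
    RingTheory.Sequence.IsWeaklyRegular S l := by
  refine ⟨fun i hi => ?_⟩
  have h1 := isRegularMod_iff.1 (h i hi)
  have h2 : (Ideal.ofList (l.take i) • ⊤ : Submodule S S) = Ideal.ofList (l.take i) := by
    rw [smul_eq_mul, Ideal.mul_top]
  rw [h2]
  exact h1

/-- The members of a regular sequence are linearly independent. -/
lemma eq_zero_of_sum_eq_zero {l : List S}
    (h : ∀ i (hi : i < l.length), IsRegularMod (Ideal.ofList (l.take i)) l[i])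
    (hne : Ideal.ofList l ≠ ⊤) {a : Fin l.length → K} (ha : ∑ i, a i • l[i] = 0) : a = 0 := by
  classical
  by_contra hcon
  obtain ⟨k₀, hk₀⟩ : ∃ k, a k ≠ 0 := by
    by_contra hall
    push Not at hall
    exact hcon (funext hall)
  -- the last index with a nonzero coefficient
  obtain ⟨k, hk, hmax⟩ := (Finset.univ.filter fun k => a k ≠ 0).exists_max_image id
    ⟨k₀, by simpa using hk₀⟩
  have hak : a k ≠ 0 := (Finset.mem_filter.1 hk).2
  have hmem : l[k] ∈ Ideal.ofList (l.take k) := by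
    rw [← Finset.add_sum_erase _ _ (Finset.mem_univ k)] at ha
    have h1 : a k • l[k] ∈ Ideal.ofList (l.take k) := by
      rw [eq_neg_of_add_eq_zero_left ha]
      refine neg_mem (Ideal.sum_mem _ fun i hi => ?_)
      by_cases hai : a i = 0
      · rw [hai, zero_smul]; exact zero_mem _
      · have hik : i ≤ k := hmax i (by simpa using hai)
        have hlt : i < k := lt_of_le_of_ne hik (Finset.ne_of_mem_erase hi)
        rw [Algebra.smul_def]
        refine Ideal.mul_mem_left _ _ (Ideal.subset_span ?_)
        change l[i] ∈ l.take k
        rw [List.mem_take_iff_getElem]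
        exact ⟨i, lt_min_iff.2 ⟨hlt, i.2⟩, rfl⟩
    have h2 := Ideal.mul_mem_left _ (algebraMap K S (a k)⁻¹) h1
    rwa [Algebra.smul_def, ← mul_assoc, ← map_mul, inv_mul_cancel₀ hak, map_one, one_mul] at h2
  have h1 := h k k.2 1 (by rw [mul_one]; exact hmem)
  apply hne
  rw [Ideal.eq_top_iff_one]
  exact Ideal.span_mono (fun x hx => List.mem_of_mem_take hx) h1

end Regular

/-- Powers of the variables form a regular sequence. -/
lemma isRegularMod_X_pow {m N : ℕ} {i : Fin n} (hi : (i : ℕ) = m) :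
    IsRegularMod (Ideal.span ((fun α => monomial α (1 : ℂ)) ''
      {α | ∃ j : Fin n, (j : ℕ) < m ∧ α = Finsupp.single j N})) (X i ^ N) := by
  intro f hf
  rw [mem_ideal_span_monomial_image] at hf ⊢
  intro α hα
  have h1 : α + Finsupp.single i N ∈ (X i ^ N * f).support := by
    rw [mem_support_iff, X_pow_eq_monomial, add_comm, coeff_monomial_mul, one_mul]
    exact mem_support_iff.1 hα
  obtain ⟨_, ⟨j, hj, rfl⟩, hle⟩ := hf _ h1
  refine ⟨_, ⟨j, hj, rfl⟩, ?_⟩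
  have hne : i ≠ j := by rintro rfl; omega
  have h2 := hle j
  rw [Finsupp.single_le_iff]
  simpa [Finsupp.single_apply, hne] using h2

lemma depthGE_of_X_pow_mem {I : Ideal (MvPolynomial (Fin n) ℂ)} {κ N : ℕ} (hκ : κ ≤ n)
    (hI : ∀ i : Fin n, (i : ℕ) < κ → X i ^ N ∈ I) : DepthGE I κ ⊥ := by
  -- the powers of the first `κ - r` variables can be completed by `r` further elements
  have key : ∀ r ≤ κ, DepthGE I r (Ideal.span ((fun α => monomial α (1 : ℂ)) ''
      {α | ∃ j : Fin n, (j : ℕ) < κ - r ∧ α = Finsupp.single j N})) := by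
    intro r
    induction r with
    | zero => exact fun _ => trivial
    | succ r ih =>
      intro hr
      have hlt : κ - (r + 1) < n := by omega
      refine ⟨X ⟨κ - (r + 1), hlt⟩ ^ N, hI _ (by simp; omega), isRegularMod_X_pow rfl, ?_⟩
      convert ih (by omega) using 1
      rw [← Ideal.span_union, X_pow_eq_monomial, ← Set.image_singleton
        (f := fun α => monomial α (1 : ℂ)), ← Set.image_union]
      congr 2
      ext α
      simp only [Set.mem_union, Set.mem_ofPred_eq, Set.mem_singleton_iff]
      constructor
      · rintro (⟨j, hj, rfl⟩ | rfl)
        · exact ⟨j, by omega, rfl⟩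
        · exact ⟨_, by simp; omega, rfl⟩
      · rintro ⟨j, hj, rfl⟩
        by_cases h : (j : ℕ) < κ - (r + 1)
        · exact Or.inl ⟨j, h, rfl⟩
        · refine Or.inr ?_
          have : j = ⟨κ - (r + 1), hlt⟩ := Fin.ext (by simp; omega)
          rw [this]
  have h := key κ le_rfl
  convert h using 1
  rw [eq_comm, Ideal.span_eq_bot]
  rintro _ ⟨α, ⟨j, hj, -⟩, -⟩
  omega

/-! ### Initial forms -/

lemma homogeneousComponent_eq_zero_of_mem_weightIdeal {f : MvPolynomial (Fin n) ℂ} {c m : ℕ}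
    (h : f ∈ weightIdeal 1 c) (hm : m < c) : homogeneousComponent m f = 0 := by
  ext α
  rw [coeff_homogeneousComponent, coeff_zero]
  split_ifs with hα
  · by_contra h0
    have := mem_weightIdeal_one.1 h α h0
    omega
  · rfl

lemma initialDegree_eq {f : MvPolynomial (Fin n) ℂ} {d : ℕ} (h : f ∈ weightIdeal 1 d)
    (h0 : homogeneousComponent d f ≠ 0) : initialDegree f = d := by
  refine le_antisymm ?_ ?_
  · obtain ⟨α, hα⟩ := MvPolynomial.exists_coeff_ne_zero h0
    rw [coeff_homogeneousComponent] at hα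
    split_ifs at hα with hd
    · rw [← hd]
      exact iInf₂_le α (mem_support_iff.2 hα)
    · exact absurd rfl hα
  · exact le_iInf₂ fun α hα => by
      exact_mod_cast mem_weightIdeal_one.1 h α (mem_support_iff.1 hα)

lemma initialForm_eq {f : MvPolynomial (Fin n) ℂ} {d : ℕ} (h : f ∈ weightIdeal 1 d)
    (h0 : homogeneousComponent d f ≠ 0) : initialForm f = homogeneousComponent d f := by
  rw [initialForm, initialDegree_eq h h0, ENat.toNat_natCast]

lemma homogeneousComponent_one_of_sub_mem {f : MvPolynomial (Fin n) ℂ} {j : Fin n}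
    (h : f - X j ∈ weightIdeal 1 2) : homogeneousComponent 1 f = X j := by
  have h1 := homogeneousComponent_eq_zero_of_mem_weightIdeal h one_lt_two
  rw [map_sub, sub_eq_zero] at h1
  rw [h1]
  exact homogeneousComponent_of_mem (isHomogeneous_X ℂ j) |>.trans (if_pos rfl)

lemma initialForm_of_sub_mem {f : MvPolynomial (Fin n) ℂ} {j : Fin n}
    (h : f - X j ∈ weightIdeal 1 2) : initialForm f = X j := by
  have h1 := homogeneousComponent_one_of_sub_mem h
  rw [initialForm_eq (d := 1) ?_ (by rw [h1]; exact X_ne_zero j), h1]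
  have := add_mem (weightIdeal_anti 1 one_le_two h)
    (X_mem_weightIdeal (R := ℂ) (w := (1 : Fin n → ℕ)) (c := 1) (i := j) le_rfl)
  simpa using this

lemma initialForms_eq_ofFn (P : SquareSystem n) {κ : ℕ} (hκ : κ ≤ n) :
    initialForms P κ = List.ofFn fun k : Fin κ => initialForm (P (Fin.castLE hκ k)) := by
  have h : ((List.finRange n).filter fun i : Fin n => (i : ℕ) < κ) =
      (List.finRange κ).map (Fin.castLE hκ) := by
    refine List.Pairwise.eq_of_mem_iff (r := (· < ·))
      ((List.pairwise_lt_finRange n).filter _) ?_ fun i => ?_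
    · rw [List.pairwise_map]
      exact List.pairwise_lt_finRange κ
    · simp only [List.mem_filter, List.mem_finRange, true_and, decide_eq_true_eq, List.mem_map]
      exact ⟨fun h => ⟨⟨i, h⟩, rfl⟩, by rintro ⟨k, rfl⟩; exact k.2⟩
  rw [initialForms, h, List.map_map, List.ofFn_eq_map]
  rfl

/-! ### Recombination of the equations with constant coefficients -/

/-- By prime avoidance and the exchange property of regular sequences, forms whose ideal contains
powers of `κ` of the variables become a regular sequence after a constant change of basis. -/
lemma exists_isUnit_isRegular {κ N : ℕ} (hκ : κ ≤ n) {f : Fin κ → MvPolynomial (Fin n) ℂ}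
    (hf0 : ∀ k, coeff 0 (f k) = 0)
    (hX : ∀ i : Fin n, (i : ℕ) < κ → X i ^ N ∈ Ideal.span (Set.range f)) :
    ∃ c : Matrix (Fin κ) (Fin κ) ℂ, IsUnit c ∧
      (∀ k, ∑ j, c k j • f j ≠ 0) ∧
      RingTheory.Sequence.IsRegular (MvPolynomial (Fin n) ℂ)
        (List.ofFn fun k => ∑ j, c k j • f j) := by
  classical
  set V : Submodule ℂ (MvPolynomial (Fin n) ℂ) := Submodule.span ℂ (Set.range f) with hV
  have hle : Ideal.span (Set.range f) ≤ Ideal.span (V : Set (MvPolynomial (Fin n) ℂ)) :=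
    Ideal.span_mono Submodule.subset_span
  obtain ⟨l, rfl, hlV, hl⟩ := DepthGE.exists_list V κ ⊥
    (depthGE_of_X_pow_mem hκ fun i hi => hle (hX i hi))
  simp only [bot_sup_eq] at hl
  have hmem0 : ∀ x ∈ l, x ∈ weightIdeal (1 : Fin n → ℕ) 1 := by
    intro x hx
    have hVle : V ≤ (weightIdeal (1 : Fin n → ℕ) 1 :
        Ideal (MvPolynomial (Fin n) ℂ)).restrictScalars ℂ := by
      rw [hV, Submodule.span_le]
      rintro _ ⟨k, rfl⟩
      exact mem_weightIdeal_one_one.2 (hf0 k)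
    exact hVle (hlV x hx)
  have hne : Ideal.ofList l ≠ ⊤ := by
    intro h
    have h1 : (1 : MvPolynomial (Fin n) ℂ) ∈ weightIdeal (1 : Fin n → ℕ) 1 := by
      have : Ideal.ofList l ≤ weightIdeal (1 : Fin n → ℕ) 1 := Ideal.span_le.2 hmem0
      exact this (h ▸ Submodule.mem_top)
    simpa using mem_weightIdeal_one_one.1 h1
  have hc : ∀ k : Fin l.length, ∃ c : Fin l.length → ℂ, ∑ j, c j • f j = l[k] := fun k =>
    (Submodule.mem_span_range_iff_exists_fun ℂ).1 (hlV _ (List.getElem_mem _))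
  choose c hc using hc
  refine ⟨Matrix.of c, ?_, fun k h => ?_, ?_, ?_⟩
  · rw [← Matrix.vecMul_injective_iff_isUnit]
    refine (injective_iff_map_eq_zero (Matrix.of c).vecMulLinear).2 fun a ha => ?_
    refine eq_zero_of_sum_eq_zero (K := ℂ) hl hne ?_
    have ha' : ∀ j, ∑ k, a k * c k j = 0 := fun j => congrFun ha j
    calc ∑ k, a k • l[k] = ∑ k, ∑ j, (a k * c k j) • f j := by
          refine Finset.sum_congr rfl fun k _ => ?_
          rw [← hc k, Finset.smul_sum]
          simp only [smul_smul]
      _ = ∑ j, (∑ k, a k * c k j) • f j := by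
          rw [Finset.sum_comm]
          simp only [Finset.sum_smul]
      _ = 0 := by simp [ha']
  · have h1 := eq_zero_of_sum_eq_zero (K := ℂ) hl hne (a := Pi.single k 1) (by
      rw [Finset.sum_eq_single k]
      · rw [Pi.single_eq_same, one_smul, ← hc k]; exact h
      · intro b _ hb; rw [Pi.single_eq_of_ne hb, zero_smul]
      · simp)
    simpa using congrFun h1 k
  · have : (List.ofFn fun k => ∑ j, Matrix.of c k j • f j) = l := by
      simp only [Matrix.of_apply, hc]
      exact List.ofFn_getElem
    rw [this]
    exact isWeaklyRegular_of_isRegularMod hl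
  · have : (List.ofFn fun k => ∑ j, Matrix.of c k j • f j) = l := by
      simp only [Matrix.of_apply, hc]
      exact List.ofFn_getElem
    rw [this, smul_eq_mul, Ideal.mul_top]
    exact hne.symm

/-- The block matrix with the blocks `c` and `1`. -/
def extendMatrix {κ : ℕ} (c : Matrix (Fin κ) (Fin κ) ℂ) : Matrix (Fin n) (Fin n) ℂ :=
  Matrix.of fun i j => if hi : (i : ℕ) < κ then
    if hj : (j : ℕ) < κ then c ⟨i, hi⟩ ⟨j, hj⟩ else 0 else if i = j then 1 else 0

lemma sum_dite_lt {M : Type*} [AddCommMonoid M] {κ : ℕ} (hκ : κ ≤ n) (g : Fin κ → M) :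
    ∑ j : Fin n, (if h : (j : ℕ) < κ then g ⟨j, h⟩ else 0) = ∑ k, g k := by
  obtain ⟨m, rfl⟩ := Nat.exists_eq_add_of_le hκ
  rw [Fin.sum_univ_add]
  simp

lemma extendMatrix_sum_of_lt {M : Type*} [AddCommMonoid M] [Module ℂ M] {κ : ℕ} (hκ : κ ≤ n)
    (c : Matrix (Fin κ) (Fin κ) ℂ) (v : Fin n → M) (k : Fin κ) :
    ∑ j, (extendMatrix c : Matrix (Fin n) (Fin n) ℂ) (Fin.castLE hκ k) j • v j =
      ∑ j, c k j • v (Fin.castLE hκ j) := by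
  rw [← sum_dite_lt hκ]
  refine Finset.sum_congr rfl fun j _ => ?_
  by_cases hj : (j : ℕ) < κ
  · simp [extendMatrix, hj]
  · simp [extendMatrix, hj]

lemma extendMatrix_sum_of_le {M : Type*} [AddCommMonoid M] [Module ℂ M] {κ : ℕ}
    (c : Matrix (Fin κ) (Fin κ) ℂ) (v : Fin n → M) {i : Fin n} (hi : κ ≤ (i : ℕ)) :
    ∑ j, (extendMatrix c : Matrix (Fin n) (Fin n) ℂ) i j • v j = v i := by
  simp [extendMatrix, not_lt.2 hi]

lemma isUnit_extendMatrix {κ : ℕ} (hκ : κ ≤ n) {c : Matrix (Fin κ) (Fin κ) ℂ} (hc : IsUnit c) :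
    IsUnit (extendMatrix c : Matrix (Fin n) (Fin n) ℂ) := by
  rw [← Matrix.mulVec_injective_iff_isUnit]
  refine (injective_iff_map_eq_zero (extendMatrix c).mulVecLin).2 fun v hv => ?_
  have hv' : ∀ i, ∑ j, (extendMatrix c : Matrix (Fin n) (Fin n) ℂ) i j • v j = 0 :=
    fun i => congrFun hv i
  have h1 : (fun k => v (Fin.castLE hκ k)) = 0 := by
    refine Matrix.mulVec_injective_iff_isUnit.2 hc ?_
    rw [Matrix.mulVec_zero]
    funext k
    exact (extendMatrix_sum_of_lt hκ c v k).symm.trans (hv' _)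
  funext i
  by_cases hi : (i : ℕ) < κ
  · exact congrFun h1 ⟨i, hi⟩
  · exact (extendMatrix_sum_of_le c v (not_lt.1 hi)).symm.trans (hv' i)

/-! ### The pre-inflatable system -/

lemma IsNormalForm.isPure_of_coeff_homogeneousComponent {P : SquareSystem n} {κ d : ℕ}
    (hP : IsNormalForm P κ d) {i : Fin n} (hi : (i : ℕ) < κ) {α : Fin n →₀ ℕ}
    (hα : coeff α (homogeneousComponent d (P i)) ≠ 0) : IsPure κ α := by
  rw [coeff_homogeneousComponent] at hα
  split_ifs at hα with hd
  · by_contra h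
    exact absurd hd (hP.mixed_high i hi α hα h).ne'
  · exact absurd rfl hα

/-- By the Nullstellensatz, forms in the first `κ` variables without a common nontrivial zero
generate an ideal which contains powers of these variables. -/
lemma exists_X_pow_mem {κ : ℕ} {f : Fin κ → MvPolynomial (Fin n) ℂ}
    (hpure : ∀ k α, coeff α (f k) ≠ 0 → IsPure κ α)
    (hne : ∀ a : Fin n → ℂ, (∀ j : Fin n, κ ≤ (j : ℕ) → a j = 0) → a ≠ 0 →
      ∃ k, eval a (f k) ≠ 0) :
    ∃ N, ∀ i : Fin n, (i : ℕ) < κ → X i ^ N ∈ Ideal.span (Set.range f) := by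
  have hrad : ∀ i : Fin n, (i : ℕ) < κ → X i ∈ (Ideal.span (Set.range f)).radical := by
    intro i hi
    rw [← vanishingIdeal_zeroLocus_eq_radical (K := ℂ)]
    intro x hx
    by_contra hxi
    rw [aeval_X] at hxi
    -- the point with the same first `κ` coordinates and the other coordinates zero
    set a : Fin n → ℂ := fun j => if (j : ℕ) < κ then x j else 0 with ha
    obtain ⟨k, hk⟩ := hne a (fun j hj => by simp [ha, not_lt.2 hj]) (fun h => hxi (by
      have := congrFun h i
      simpa [ha, hi] using this))
    apply hk
    have hxk : eval x (f k) = 0 := by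
      have := hx (f k) (Ideal.subset_span ⟨k, rfl⟩)
      rwa [aeval_eq_eval] at this
    rw [← hxk, eval_eq, eval_eq]
    refine Finset.sum_congr rfl fun α hα => ?_
    congr 1
    refine Finset.prod_congr rfl fun j _ => ?_
    by_cases hj : (j : ℕ) < κ
    · simp [ha, hj]
    · rw [hpure k α (mem_support_iff.1 hα) j (not_lt.1 hj), pow_zero, pow_zero]
  have h1 : ∀ i : Fin n, ∃ N, (i : ℕ) < κ → X i ^ N ∈ Ideal.span (Set.range f) := fun i => by
    by_cases hi : (i : ℕ) < κ
    · obtain ⟨N, hN⟩ := hrad i hi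
      exact ⟨N, fun _ => hN⟩
    · exact ⟨0, fun h => absurd h hi⟩
  choose N hN using h1
  exact ⟨∑ i, N i, fun i hi => Ideal.pow_mem_of_pow_mem _ (hN i hi)
    (Finset.single_le_sum (fun _ _ => Nat.zero_le _) (Finset.mem_univ i))⟩

/-- A constant recombination of the first `κ` equations preserves the normal form. -/
lemma IsNormalForm.recombine {P : SquareSystem n} {κ d : ℕ} (hP : IsNormalForm P κ d)
    (hκ : κ ≤ n) {Q : SquareSystem n} (c : Matrix (Fin κ) (Fin κ) ℂ)
    (hQlt : ∀ k : Fin κ, Q (Fin.castLE hκ k) = ∑ j, c k j • P (Fin.castLE hκ j))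
    (hQle : ∀ i : Fin n, κ ≤ (i : ℕ) → Q i = P i) : IsNormalForm Q κ d where
  low i hi := by
    rw [show i = Fin.castLE hκ ⟨i, hi⟩ from rfl, hQlt]
    exact Ideal.sum_mem _ fun j _ => Submodule.smul_of_tower_mem _ _ (hP.low _ j.2)
  lin j hj := by rw [hQle j hj]; exact hP.lin j hj
  pure_high j hj := by rw [hQle j hj]; exact hP.pure_high j hj
  mixed_high i hi α hα hm := by
    rw [show i = Fin.castLE hκ ⟨i, hi⟩ from rfl, hQlt, coeff_sum] at hα
    obtain ⟨j, -, hj⟩ := Finset.exists_ne_zero_of_sum_ne_zero hα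
    rw [coeff_smul] at hj
    exact hP.mixed_high _ j.2 α (right_ne_zero_of_smul hj) hm

lemma IsNormalForm.jacobian_zero {P : SquareSystem n} {κ d : ℕ} (hP : IsNormalForm P κ d) :
    jacobian P 0 = Matrix.diagonal fun i : Fin n => if (i : ℕ) < κ then 0 else 1 := by
  classical
  have h2 : ∀ {f : MvPolynomial (Fin n) ℂ} (j : Fin n), f ∈ weightIdeal 1 2 →
      coeff (Finsupp.single j 1) f = 0 := by
    intro f j hf
    by_contra h
    have := mem_weightIdeal_one.1 hf _ h
    rw [Finsupp.degree_single] at this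
    omega
  ext i j
  rw [jacobian_zero_apply]
  by_cases hi : (i : ℕ) < κ
  · rw [h2 j (hP.low i hi), Matrix.diagonal_apply]
    simp [hi]
  · have h := h2 j (hP.lin i (not_lt.1 hi))
    rw [coeff_sub, sub_eq_zero] at h
    rw [h, coeff_X, Matrix.diagonal_apply]
    by_cases hij : i = j
    · subst hij; simp [hi]
    · rw [if_neg hij, if_neg fun h => hij (Finsupp.single_left_injective one_ne_zero h)]

lemma IsNormalForm.mem_jacobianKer {P : SquareSystem n} {κ d : ℕ} (hP : IsNormalForm P κ d)
    {v : Fin n → ℂ} : v ∈ jacobianKer P 0 ↔ ∀ j : Fin n, κ ≤ (j : ℕ) → v j = 0 := by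
  rw [jacobianKer, LinearMap.mem_ker, Matrix.mulVecLin_apply, hP.jacobian_zero, funext_iff]
  refine forall_congr' fun j => ?_
  rw [Matrix.mulVec_diagonal]
  by_cases hj : (j : ℕ) < κ
  · simp [hj]
  · simp [hj, not_lt.1 hj]

lemma IsNormalForm.jacobianKer_eq {P : SquareSystem n} {κ d : ℕ} (hP : IsNormalForm P κ d) :
    jacobianKer P 0 =
      Submodule.span ℂ {v | ∃ i : Fin n, (i : ℕ) < κ ∧ v = Pi.single i 1} := by
  classical
  refine le_antisymm (fun v hv => ?_) (Submodule.span_le.2 ?_)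
  · rw [← Finset.univ_sum_single v]
    refine Submodule.sum_mem _ fun i _ => ?_
    by_cases hi : (i : ℕ) < κ
    · have : (Pi.single i (v i) : Fin n → ℂ) = v i • Pi.single i 1 := by
        rw [← Pi.single_smul, smul_eq_mul, mul_one]
      rw [this]
      exact Submodule.smul_mem _ _ (Submodule.subset_span ⟨i, hi, rfl⟩)
    · rw [hP.mem_jacobianKer.1 hv i (not_lt.1 hi), Pi.single_zero]
      exact zero_mem _
  · rintro _ ⟨i, hi, rfl⟩
    refine hP.mem_jacobianKer.2 fun j hj => Pi.single_eq_of_ne ?_ _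
    rintro rfl
    omega

lemma IsNormalForm.breadth_eq {P : SquareSystem n} {κ d : ℕ} (hP : IsNormalForm P κ d)
    (hκ : κ ≤ n) : breadth P 0 = κ := by
  classical
  have h : jacobianKer P 0 = Submodule.span ℂ
      (Set.range fun k : Fin κ => (Pi.single (Fin.castLE hκ k) 1 : Fin n → ℂ)) := by
    rw [hP.jacobianKer_eq]
    congr 1
    ext v
    exact ⟨fun ⟨i, hi, hv⟩ => ⟨⟨i, hi⟩, hv.symm⟩, fun ⟨k, hk⟩ => ⟨_, k.2, hk.symm⟩⟩
  have hli : LinearIndependent ℂ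
      fun k : Fin κ => (Pi.single (Fin.castLE hκ k) 1 : Fin n → ℂ) :=
    (Pi.linearIndependent_single_one (Fin n) ℂ).comp _ (Fin.castLE_injective hκ)
  rw [breadth, h, finrank_span_eq_card hli, Fintype.card_fin]

lemma exists_isNormalForm_of_isRegularZero {κ d : ℕ} {ord : GradedLocalOrder n}
    {G : SquareSystem n} {z : Fin n → ℂ} (hz : IsRegularZero ord G z κ d) (hκ : κ ≤ n) :
    ∃ P, LocallyEquivalent (translate G z) P ∧ IsNormalForm P κ d ∧
      (∀ i : Fin n, (i : ℕ) < κ → P i ∈ weightIdeal 1 d) ∧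
      (∀ k, truncLength (Ideal.span (Set.range P)) k ≤ d ^ κ) := by
  obtain ⟨hiso, hbr, hser⟩ := hz
  have hbr0 : breadth (translate G z) 0 = κ := by
    rw [← hbr, breadth, breadth, jacobianKer, jacobianKer, jacobian_translate]
  obtain ⟨P, hGP, hP⟩ := exists_normalForm (isIsolatedZero_translate hiso).1 hbr0 d
  have hlen : ∀ k, truncLength (Ideal.span (Set.range P)) k = (boxLT κ d k).card := fun k => by
    rw [hGP.truncLength_eq, truncLength_eq_card ord hser]
  exact ⟨P, hGP, hP, fun i hi => hP.order_ge hκ (hlen d) i hi,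
    fun k => (hlen k).trans_le (card_boxLT_le κ d k)⟩

/-- After a constant recombination of the first `κ` equations, their forms of degree `d` are a
regular sequence. -/
lemma IsNormalForm.exists_isRegular {P : SquareSystem n} {κ d : ℕ} (hP : IsNormalForm P κ d)
    (hκ : κ ≤ n) (hord : ∀ i : Fin n, (i : ℕ) < κ → P i ∈ weightIdeal 1 d)
    (hlen : ∀ k, truncLength (Ideal.span (Set.range P)) k ≤ d ^ κ) :
    ∃ Q, LocallyEquivalent P Q ∧ IsNormalForm Q κ d ∧
      (∀ i : Fin n, (i : ℕ) < κ → Q i ∈ weightIdeal 1 d) ∧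
      (∀ k : Fin κ, homogeneousComponent d (Q (Fin.castLE hκ k)) ≠ 0) ∧
      RingTheory.Sequence.IsRegular (MvPolynomial (Fin n) ℂ)
        (List.ofFn fun k : Fin κ => homogeneousComponent d (Q (Fin.castLE hκ k))) := by
  set f : Fin κ → MvPolynomial (Fin n) ℂ :=
    fun k => homogeneousComponent d (P (Fin.castLE hκ k)) with hf
  have hf0 : ∀ k, coeff 0 (f k) = 0 := fun k => by
    rw [hf, coeff_homogeneousComponent, ite_eq_right_iff]
    intro _
    exact mem_weightIdeal_one_one.1 (weightIdeal_anti 1 one_le_two (hP.low _ k.2))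
  obtain ⟨N, hN⟩ := exists_X_pow_mem (f := f)
    (fun k α => hP.isPure_of_coeff_homogeneousComponent k.2) fun a ha ha0 => by
      obtain ⟨i, hi, hne⟩ := hP.exists_eval_ne_zero hκ hord hlen ha ha0
      exact ⟨⟨i, hi⟩, hne⟩
  obtain ⟨c, hc, hc0, hreg⟩ := exists_isUnit_isRegular hκ hf0 hN
  set Q := ((extendMatrix c : Matrix (Fin n) (Fin n) ℂ).map C).mulVec P with hQ
  have hQsum : ∀ i, Q i = ∑ j, (extendMatrix c : Matrix (Fin n) (Fin n) ℂ) i j • P j := fun i => by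
    simp only [hQ, Matrix.mulVec, dotProduct, Matrix.map_apply, smul_eq_C_mul]
  have hQlt : ∀ k : Fin κ, Q (Fin.castLE hκ k) = ∑ j, c k j • P (Fin.castLE hκ j) := fun k => by
    rw [hQsum, extendMatrix_sum_of_lt]
  have hQle : ∀ i : Fin n, κ ≤ (i : ℕ) → Q i = P i := fun i hi => by
    rw [hQsum, extendMatrix_sum_of_le c P hi]
  have hcomp : ∀ k : Fin κ,
      homogeneousComponent d (Q (Fin.castLE hκ k)) = ∑ j, c k j • f j := fun k => by
    rw [hQlt, map_sum]
    simp only [map_smul, hf]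
  refine ⟨Q, LocallyEquivalent.of_mulVec ?_, hP.recombine hκ c hQlt hQle, fun i hi => ?_,
    fun k => ?_, ?_⟩
  · have : ((extendMatrix c : Matrix (Fin n) (Fin n) ℂ).map C).map (eval (0 : Fin n → ℂ)) =
        extendMatrix c := by
      ext i j
      simp
    rw [this]
    exact isUnit_extendMatrix hκ hc
  · rw [show i = Fin.castLE hκ ⟨i, hi⟩ from rfl, hQlt]
    exact Ideal.sum_mem _ fun j _ => Submodule.smul_of_tower_mem _ _ (hord _ j.2)
  · rw [hcomp]
    exact hc0 k
  · simp only [hcomp]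
    exact hreg

end Inflation

end

theorem mainTheorem3 (n κ d : ℕ) (ord : Inflation.GradedLocalOrder n)
    (G : Inflation.SquareSystem n) (z : Fin n → ℂ)
    (hz : Inflation.IsRegularZero ord G z κ d) :
    ∃ P : Inflation.SquareSystem n,
      Inflation.IsLocallyInvertibleTransform G z P ∧
      Inflation.IsRegularZero ord P 0 κ d ∧
      Inflation.IsPreInflatable P κ d d ∧
      (∀ i : Fin n, (i : ℕ) < κ → Inflation.initialDegree (P i) = (d : ℕ∞)) ∧
      (∀ x : Fin n → ℂ, (∀ j : Fin n, κ ≤ (j : ℕ) → x j = 0) → ∑ j, ‖x j‖ ^ 2 = 1 →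
        ∃ i : Fin n, (i : ℕ) < κ ∧ MvPolynomial.eval x (Inflation.initialForm (P i)) ≠ 0) ∧
      RingTheory.Sequence.IsRegular (MvPolynomial (Fin n) ℂ) (Inflation.initialForms P κ) ∧
      (∀ i : Fin n, κ ≤ (i : ℕ) →
        Inflation.initialForm (P i) = MvPolynomial.X i) := by
  open Inflation MvPolynomial in
  have hκ : κ ≤ n := by
    rw [← hz.2.1, breadth]
    simpa using (jacobianKer G z).finrank_le
  obtain ⟨Q, hGQ, hQ, hQord, hQlen⟩ := exists_isNormalForm_of_isRegularZero hz hκ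
  obtain ⟨P, hQP, hP, hord, hne, hreg⟩ := hQ.exists_isRegular hκ hQord hQlen
  have hGP : LocallyEquivalent (translate G z) P := hGQ.trans hQP
  have hlen : ∀ k, truncLength (Ideal.span (Set.range P)) k ≤ d ^ κ := fun k => by
    rw [hQP.truncLength_eq]
    exact hQlen k
  have hdeg : ∀ i : Fin n, (i : ℕ) < κ → initialDegree (P i) = d := fun i hi =>
    initialDegree_eq (hord i hi) (hne ⟨i, hi⟩)
  have hform : ∀ i : Fin n, (i : ℕ) < κ → initialForm (P i) = homogeneousComponent d (P i) :=
    fun i hi => initialForm_eq (hord i hi) (hne ⟨i, hi⟩)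
  have hiso : IsIsolatedZero P 0 := hGP.isIsolatedZero (isIsolatedZero_translate hz.1)
  refine ⟨P, hGP.isLocallyInvertibleTransform, ⟨hiso, hP.breadth_eq hκ, ?_⟩,
    ⟨hiso, hP.breadth_eq hκ, hP.jacobianKer_eq, fun i hi α hα h => ?_, fun i hi α hα h => ?_⟩,
    hdeg, fun x hx hx1 => ?_, ?_, fun i hi => initialForm_of_sub_mem (hP.lin i hi)⟩
  · rw [translate_zero, ← hz.2.2]
    exact hilbertSeries_eq_of_truncLength_eq ord hGP.truncLength_eq
  · refine hP.mixed_high i hi α (mem_support_iff.1 hα) fun hpure => ?_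
    obtain ⟨j, hj, hj0⟩ := h
    exact hj0 (hpure j hj)
  · exact hP.pure_high i hi α (mem_support_iff.1 hα) h
  · have hx0 : x ≠ 0 := by
      rintro rfl
      simp at hx1
    obtain ⟨i, hi, h⟩ := hP.exists_eval_ne_zero hκ hord hlen hx hx0
    exact ⟨i, hi, by rwa [hform i hi]⟩
  · rw [initialForms_eq_ofFn P hκ]
    have : (fun k : Fin κ => initialForm (P (Fin.castLE hκ k))) =
        fun k : Fin κ => homogeneousComponent d (P (Fin.castLE hκ k)) :=
      funext fun k => hform _ k.2
    rw [this]
    exact hreg
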